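/- **Theorem (Propagation of independence).** Let $\mathbb D=\mathbb R^d$ or $\mathbb D=\mathbb T^d=\mathbb R^d/\mathbb Z^d$ (with the Euclidean, respectively flat geodesic, distance; displacements in $\mathbb R^d$ act on $\mathbb T^d$ modulo $\mathbb Z^d$), and let $\mu:\mathbb D\to\mathbb R^d$, $\sigma:\mathbb D\times\mathbb D\to\mathbb R^d$, $\alpha,\beta:\mathbb D\times\mathbb D\to\mathbb R$, $\nu\ge 0$, where $\mu,\sigma,\alpha,\beta$ are bounded and Lipschitz and $\alpha(x,y)=\alpha_1(x)\alpha_2(y)$ with bounded $\alpha_1,\alpha_2$. Let $(\Omega,\mathcal A,\pi)$ be a probability space, $X_{(0)}:\Omega\to\mathbb D$ and $w_{(0)}:\Omega\times\Omega\to\mathbb R$ measurable with $\int_\Omega|X_{(0)}|^2\,d\pi<\infty$ and $\|w_{(0)}\|_{L^\infty(\pi\otimes\pi)}<\infty$. Let $T\ge 0$ and let $(B(t))_{t\in[0,T]}$ be a standard $d$-dimensional Brownian motion on a filtered probability space $(\widehat\Omega,(\widehat{\mathcal F}_t)_{t\in[0,T]},\widehat\pi)$. A *McKean–Vlasov solution*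 is a pair $\overline X_{\xi,\widehat\xi}(t)\in\mathbb D$, $\overline w_{\xi,\widehat\xi,\zeta,\widehat\zeta}(t)\in\mathbb R$, $t\in[0,T]$, such that $\overline X(t)$ is $\mathcal A\otimes\widehat{\mathcal F}_t$-measurable and $\overline w(t)$ is $(\mathcal A\otimes\widehat{\mathcal F}_t)^{\otimes2}$-measurable (up to null sets), $\overline X(t)\in L^2(\pi\otimes\widehat\pi)$ and $\overline w(t)\in L^\infty((\pi\otimes\widehat\pi)^{\otimes 2})$ for every $t$, the paths are almost surely continuous, and, with initial data $\overline X(0)=X_{(0)}$ and $\overline w(0)=w_{(0)}$, for a.e. $(\xi,\widehat\xi)$ and a.e. pair $(\xi,\widehat\xi),(\zeta,\widehat\zeta)$ respectively, $$d\overline X_{\xi,\widehat\xi}=\mu(\overline X_{\xi,\widehat\xi})\,dt+\nu\,dB_{\widehat\xi}+\mathbb E_{(\zeta,\widehat\zeta)\sim\pi\otimes\widehat\pi}\big[\overline w_{\xi,\widehat\xi,\zeta,\widehat\zeta}\,\sigma(\overline X_{\xi,\widehat\xi},\overline X_{\zeta,\widehat\zeta})\big]dt,$$ $$d\overline w_{\xi,\widehat\xi,\zeta,\widehat\zeta}=\alpha(\overline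 X_{\xi,\widehat\xi},\overline X_{\zeta,\widehat\zeta})\,\overline w_{\xi,\widehat\xi,\zeta,\widehat\zeta}\,dt+\beta(\overline X_{\xi,\widehat\xi},\overline X_{\zeta,\widehat\zeta})\,dt.$$ Let $N\ge1$ and let $\pi_1,\dots,\pi_N$ be probability measures on $(\Omega,\mathcal A)$, absolutely continuous with respect to $\pi$, with $\frac1N\sum_{i=1}^N\pi_i=\pi$. Work on the (completed) independent mixture space $\big((\Omega\times\widehat\Omega)^N,(\mathcal A\otimes\widehat{\mathcal F})^{\otimes N},\bigotimes_{i=1}^N(\pi_i\otimes\widehat\pi)\big)$, whose elements are written $((\xi_i,\widehat\xi_i))_{i\in[N]}$, and put $\boldsymbol B_i(t)=B_{\widehat\xi_i}(t)$. Then: 1. There is an adapted process $((\boldsymbol X_i(t))_{i},(\boldsymbol w_{i,j}(t))_{i\ne j})_{t\in[0,T]}$ with almost surely continuous paths, unique up to almost sure equality for all $t\in[0,T]$ simultaneously, that satisfies, for every realization, $\boldsymbol X_i(0)=(X_{(0)})_{\xi_i}$ and $\boldsymbol w_{i,j}(0)=(w_{(0)})_{\xi_i,\xi_j}$ ($i\neq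 j$), and almost surely $$d\boldsymbol X_i=\mu(\boldsymbol X_i)\,dt+\nu\,d\boldsymbol B_i+\frac1N\sum_{j\ne i}\boldsymbol w_{i,j}\,\sigma(\boldsymbol X_i,\boldsymbol X_j)\,dt,\qquad d\boldsymbol w_{i,j}=\alpha(\boldsymbol X_i,\boldsymbol X_j)\,\boldsymbol w_{i,j}\,dt+\beta(\boldsymbol X_i,\boldsymbol X_j)\,dt\quad(i\neq j).$$ 2. For every McKean–Vlasov solution $(\overline X,\overline w)$, its independent mixture sampling $\overline{\boldsymbol X}_i(t)=\overline X_{\xi_i,\widehat\xi_i}(t)$, $\overline{\boldsymbol w}_{i,j}(t)=\overline w_{\xi_i,\widehat\xi_i,\xi_j,\widehat\xi_j}(t)$ ($i\neq j$) satisfies, for every $t\in[0,T]$, $$\sup_{i\in[N]}\mathbb E\big[|\boldsymbol X_i(t)-\overline{\boldsymbol X}_i(t)|\big]\le C(t)N^{-1/2},\qquad \sup_{i\ne j}\mathbb E\big[|\boldsymbol w_{i,j}(t)-\overline{\boldsymbol w}_{i,j}(t)|\big]\le C(t)N^{-1/2}$$ (the expectations being finite), where $C(t)>0$ depends only on $t$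 and on a common upper bound $M$ for the suprema and Lipschitz constants of $\mu,\sigma,\alpha,\beta$, for the suprema of $|\alpha_1|,|\alpha_2|$, for $\int|X_{(0)}|^2d\pi$ and for $\|w_{(0)}\|_{L^\infty}$. -/

import Mathlib

open MeasureTheory ProbabilityTheory Set
open scoped ENNReal

noncomputable section

/-- The lattice `ℤ^d` inside `ℝ^d`. -/
def integerLattice (d : ℕ) : AddSubgroup (EuclideanSpace ℝ (Fin d)) where
  carrier := {v | ∀ i, v i ∈ Set.range ((↑) : ℤ → ℝ)}
  zero_mem' := fun _ => ⟨0, by simp⟩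
  add_mem' := by
    intro a b ha hb i
    obtain ⟨m, hm⟩ := ha i
    obtain ⟨n, hn⟩ := hb i
    exact ⟨m + n, by simp [hm, hn]⟩
  neg_mem' := by
    intro a ha i
    obtain ⟨m, hm⟩ := ha i
    exact ⟨-m, by simp [hm]⟩

instance integerLattice_isClosed (d : ℕ) :
    IsClosed (integerLattice d : Set (EuclideanSpace ℝ (Fin d))) := by
  have h : (integerLattice d : Set (EuclideanSpace ℝ (Fin d)))
      = ⋂ i, (fun v : EuclideanSpace ℝ (Fin d) => v i) ⁻¹' Set.range ((↑) : ℤ → ℝ) := by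
    ext v
    simp [integerLattice]
  rw [h]
  exact isClosed_iInter fun i =>
    Int.isClosedEmbedding_coe_real.isClosed_range.preimage (by fun_prop)

/-- The two kinds of state space: `ℝ^d` and the flat torus `𝕋^d`. -/
inductive StateSpaceKind
  | euclidean
  | torus

/-- The state space `𝔻`: either `ℝ^d` or `𝕋^d = ℝ^d / ℤ^d`. -/
def StateSpace (d : ℕ) : StateSpaceKind → Type
  | .euclidean => EuclideanSpace ℝ (Fin d)
  | .torus => EuclideanSpace ℝ (Fin d) ⧸ integerLattice d

/-- The Euclidean norm on `ℝ^d`, respectively the quotient norm on `𝕋^d` (so that the distance on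
`𝕋^d` is the geodesic distance of the flat torus). -/
instance StateSpace.instNormedAddCommGroup (d : ℕ) :
    (k : StateSpaceKind) → NormedAddCommGroup (StateSpace d k)
  | .euclidean => inferInstanceAs (NormedAddCommGroup (EuclideanSpace ℝ (Fin d)))
  | .torus => inferInstanceAs (NormedAddCommGroup (EuclideanSpace ℝ (Fin d) ⧸ integerLattice d))

/-- The canonical projection `ℝ^d → 𝔻`, through which displacements act on states: the identity
for `𝔻 = ℝ^d` and reduction modulo `ℤ^d` for `𝔻 = 𝕋^d`. -/
def StateSpace.proj (d : ℕ) : (k : StateSpaceKind) → EuclideanSpace ℝ (Fin d) →+ StateSpace d k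
  | .euclidean => AddMonoidHom.id (EuclideanSpace ℝ (Fin d))
  | .torus => QuotientAddGroup.mk' (integerLattice d)

/-- The coefficients of the system. -/
structure Coefficients (d : ℕ) (k : StateSpaceKind) where
  μ : StateSpace d k → EuclideanSpace ℝ (Fin d)
  σ : StateSpace d k → StateSpace d k → EuclideanSpace ℝ (Fin d)
  α : StateSpace d k → StateSpace d k → ℝ
  β : StateSpace d k → StateSpace d k → ℝ
  ν : ℝ

/-- `μ, σ, α, β` are bounded and Lipschitz, `α(x,y) = α₁(x) α₂(y)` with bounded `α₁, α₂`, all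
these bounds and Lipschitz constants being at most `M`, and `ν ≥ 0`. -/
structure Coefficients.IsRegular {d : ℕ} {k : StateSpaceKind} (c : Coefficients d k) (M : ℝ) :
    Prop where
  μ_bound : ∀ x, ‖c.μ x‖ ≤ M
  σ_bound : ∀ x y, ‖c.σ x y‖ ≤ M
  α_bound : ∀ x y, |c.α x y| ≤ M
  β_bound : ∀ x y, |c.β x y| ≤ M
  μ_lip : ∀ x x', ‖c.μ x - c.μ x'‖ ≤ M * dist x x'
  σ_lip : ∀ x x' y y', ‖c.σ x y - c.σ x' y'‖ ≤ M * (dist x x' + dist y y')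
  α_lip : ∀ x x' y y', |c.α x y - c.α x' y'| ≤ M * (dist x x' + dist y y')
  β_lip : ∀ x x' y y', |c.β x y - c.β x' y'| ≤ M * (dist x x' + dist y y')
  α_separable : ∃ α₁ α₂ : StateSpace d k → ℝ,
    (∀ x, |α₁ x| ≤ M) ∧ (∀ y, |α₂ y| ≤ M) ∧ ∀ x y, c.α x y = α₁ x * α₂ y
  ν_nonneg : 0 ≤ c.ν

/-- The initial state-weight triplet `(X₀, w₀, (Ω, π))` is measurable (with respect to the
completed σ-algebras), with `∫ |X₀|² dπ ≤ M` and `ess sup |w₀| ≤ M`. -/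
structure IsInitialTriplet {d : ℕ} {k : StateSpaceKind} {Ω : Type*} [MeasurableSpace Ω]
    (π : Measure Ω) (X₀ : Ω → StateSpace d k) (w₀ : Ω → Ω → ℝ) (M : ℝ) : Prop where
  X_memLp : MemLp X₀ 2 π
  X_bound : ∫ ξ, ‖X₀ ξ‖ ^ 2 ∂π ≤ M
  w_meas : AEStronglyMeasurable (fun p : Ω × Ω => w₀ p.1 p.2) (π.prod π)
  w_bound : ∀ᵐ p ∂π.prod π, |w₀ p.1 p.2| ≤ M

/-- `(B(t))_{t ∈ [0,T]}` is a standard `d`-dimensional Brownian motion on the filtered probability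
space `(Ω', (ℱ_t), P)`. Only times in `[0,T]` matter, here and below. -/
structure IsBrownianMotionOn {d : ℕ} {Ω' : Type*} [mΩ' : MeasurableSpace Ω'] (P : Measure Ω')
    (ℱ : Filtration ℝ mΩ') (T : ℝ) (B : ℝ → Ω' → EuclideanSpace ℝ (Fin d)) : Prop where
  adapted : ∀ t ∈ Icc 0 T, StronglyMeasurable[ℱ t] (B t)
  zero : ∀ᵐ ω ∂P, B 0 ω = 0
  gaussian : ∀ s ∈ Icc 0 T, ∀ t ∈ Icc s T,
    P.map (fun ω i => B t ω i - B s ω i)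
      = Measure.pi (fun _ : Fin d => gaussianReal 0 (t - s).toNNReal)
  indep : ∀ s ∈ Icc 0 T, ∀ t ∈ Icc s T,
    Indep (MeasurableSpace.comap (fun ω => B t ω - B s ω) inferInstance) (ℱ s) P
  continuous : ∀ᵐ ω ∂P, ContinuousOn (fun t => B t ω) (Icc 0 T)

/-- `(π_i)_{i ∈ [N]}` are probability measures, absolutely continuous with respect to `π`, with
`(1/N) ∑ π_i = π`. -/
structure IsIndependentMixture {Ω : Type*} [MeasurableSpace Ω] (π : Measure Ω) {N : ℕ}
    (πs : Fin N → Measure Ω) : Prop where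
  isProb : ∀ i, IsProbabilityMeasure (πs i)
  absCont : ∀ i, πs i ≪ π
  average : (N : ℝ≥0∞)⁻¹ • ∑ i, πs i = π

/-- The probability measure `⨂_{i ∈ [N]} (π_i ⊗ π')` on `(Ω × Ω')^N`. -/
def mixtureMeasure {Ω Ω' : Type*} [MeasurableSpace Ω] [MeasurableSpace Ω'] {N : ℕ}
    (πs : Fin N → Measure Ω) (π' : Measure Ω') : Measure (Fin N → Ω × Ω') :=
  Measure.pi fun i => (πs i).prod π'

section Systems

variable {d : ℕ} {k : StateSpaceKind} {Ω Ω' : Type*} [mΩ : MeasurableSpace Ω]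
  [mΩ' : MeasurableSpace Ω']

/-- The McKean–Vlasov system on `[0,T]` over `(Ω × Ω', π ⊗ π')`, in integral form, with
adaptedness (up to null sets), moment control and almost surely continuous paths. -/
structure IsMcKeanVlasovSolution (c : Coefficients d k) (π : Measure Ω) (π' : Measure Ω')
    (ℱ : Filtration ℝ mΩ') (T : ℝ) (B : ℝ → Ω' → EuclideanSpace ℝ (Fin d))
    (X₀ : Ω → StateSpace d k) (w₀ : Ω → Ω → ℝ)
    (X : ℝ → Ω × Ω' → StateSpace d k) (w : ℝ → Ω × Ω' → Ω × Ω' → ℝ) : Prop where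
  X_adapted : ∀ t ∈ Icc 0 T, AEStronglyMeasurable[mΩ.prod (ℱ t)] (X t) (π.prod π')
  w_adapted : ∀ t ∈ Icc 0 T,
    AEStronglyMeasurable[(mΩ.prod (ℱ t)).prod (mΩ.prod (ℱ t))]
      (fun p : (Ω × Ω') × (Ω × Ω') => w t p.1 p.2) ((π.prod π').prod (π.prod π'))
  X_moment : ∀ t ∈ Icc 0 T, MemLp (X t) 2 (π.prod π')
  w_moment : ∀ t ∈ Icc 0 T,
    MemLp (fun p : (Ω × Ω') × (Ω × Ω') => w t p.1 p.2) ∞ ((π.prod π').prod (π.prod π'))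
  X_continuous : ∀ᵐ a ∂π.prod π', ContinuousOn (fun t => X t a) (Icc 0 T)
  w_continuous : ∀ᵐ p ∂(π.prod π').prod (π.prod π'),
    ContinuousOn (fun t => w t p.1 p.2) (Icc 0 T)
  X_eq : ∀ᵐ a ∂π.prod π', ∀ t ∈ Icc 0 T,
    X t a = X₀ a.1 + StateSpace.proj d k
      ((∫ s in (0 : ℝ)..t,
          (c.μ (X s a) + ∫ b, w s a b • c.σ (X s a) (X s b) ∂π.prod π'))
        + c.ν • B t a.2)
  w_eq : ∀ᵐ p ∂(π.prod π').prod (π.prod π'), ∀ t ∈ Icc 0 T,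
    w t p.1 p.2 = w₀ p.1.1 p.2.1
      + ∫ s in (0 : ℝ)..t,
          (c.α (X s p.1) (X s p.2) * w s p.1 p.2 + c.β (X s p.1) (X s p.2))

/-- The `N`-agent system on `[0,T]` over the independent mixture space
`((Ω × Ω')^N, ⨂ (π_i ⊗ π'))`, in integral form, with initial data `X_i(0) = X₀(ξ_i)`,
`w_ij(0) = w₀(ξ_i, ξ_j)` for every realization, driven by `B_i(t) = B(t)(ξ'_i)`; solutions are
adapted (up to null sets) and have almost surely continuous paths. The diagonal weights are not
part of the system, so nothing is asked of `w i i`. -/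
structure IsAgentSolution (c : Coefficients d k) {N : ℕ} (πs : Fin N → Measure Ω)
    (π' : Measure Ω') (ℱ : Filtration ℝ mΩ') (T : ℝ) (B : ℝ → Ω' → EuclideanSpace ℝ (Fin d))
    (X₀ : Ω → StateSpace d k) (w₀ : Ω → Ω → ℝ)
    (X : Fin N → ℝ → (Fin N → Ω × Ω') → StateSpace d k)
    (w : Fin N → Fin N → ℝ → (Fin N → Ω × Ω') → ℝ) : Prop where
  X_adapted : ∀ i, ∀ t ∈ Icc 0 T,
    AEStronglyMeasurable[@MeasurableSpace.pi (Fin N) (fun _ => Ω × Ω')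
      (fun _ => mΩ.prod (ℱ t))] (X i t) (mixtureMeasure πs π')
  w_adapted : ∀ i j, i ≠ j → ∀ t ∈ Icc 0 T,
    AEStronglyMeasurable[@MeasurableSpace.pi (Fin N) (fun _ => Ω × Ω')
      (fun _ => mΩ.prod (ℱ t))] (w i j t) (mixtureMeasure πs π')
  X_continuous : ∀ i, ∀ᵐ a ∂mixtureMeasure πs π', ContinuousOn (fun t => X i t a) (Icc 0 T)
  w_continuous : ∀ i j, i ≠ j →
    ∀ᵐ a ∂mixtureMeasure πs π', ContinuousOn (fun t => w i j t a) (Icc 0 T)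
  X_init : ∀ i a, X i 0 a = X₀ (a i).1
  w_init : ∀ i j, i ≠ j → ∀ a, w i j 0 a = w₀ (a i).1 (a j).1
  X_eq : ∀ i, ∀ᵐ a ∂mixtureMeasure πs π', ∀ t ∈ Icc 0 T,
    X i t a = X i 0 a + StateSpace.proj d k
      ((∫ s in (0 : ℝ)..t,
          (c.μ (X i s a)
            + (N : ℝ)⁻¹ • ∑ j ∈ Finset.univ.erase i, w i j s a • c.σ (X i s a) (X j s a)))
        + c.ν • B t (a i).2)
  w_eq : ∀ i j, i ≠ j → ∀ᵐ a ∂mixtureMeasure πs π', ∀ t ∈ Icc 0 T,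
    w i j t a = w i j 0 a
      + ∫ s in (0 : ℝ)..t,
          (c.α (X i s a) (X j s a) * w i j s a + c.β (X i s a) (X j s a))

end Systems

end

/-! An agent and its McKean–Vlasov sample start from the same state and feel the same additive
noise, so both cancel in the difference, which becomes a time integral of drift differences. Adding
and subtracting the agent drift evaluated at the sampled configuration splits this difference in
two. The first piece is Lipschitz in the state and weight errors. The second compares the empirical
average of the sampled interactions with the mean over `π.prod π'`, and contains no unknown of the
agent system.

The second piece is a law of large numbers. At a fixed time the samples are independent, though not
identically distributed. Centring each interaction at its conditional mean given sample `i` leaves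
terms that are pairwise orthogonal in L² (`integral_inner_fluctuation_eq_zero`), so their average is
of order `N^{-1/2}`. Since the laws `πs j` average to `π`, the conditional means recombine into the
mean-field interaction, up to the missing self-interaction, of order `1/N`
(`IsIndependentMixture.integral_norm_empirical_sub_le`). Grönwall's inequality for the L¹ errors of
all states and off-diagonal weights together then gives `comparison_estimate`.

The product of weight and interaction is only locally Lipschitz. What saves the argument is that the
weight equation is affine in the weight with bounded coefficients, so weights in both systems are
almost surely below the deterministic constant `weightBound M T` (`abs_le_weightBound`). The same
bound gives existence: truncating the weights there makes the field bounded and globally Lipschitz,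
the noise is absorbed into the states, Picard iteration gives an adapted solution, and the
truncation turns out never to act. Uniqueness is a pathwise Grönwall argument.

Solutions are measurable and continuous only up to null sets, so the estimates are made on
everywhere continuous versions with everywhere bounded weights. -/

noncomputable section

/-! ### Grönwall's inequality and Riemann sums. -/

section Calculus

open Filter Topology

/-- Grönwall's inequality for a bounded family of functions that are only compared through common
continuous majorants, so that no measurability of the family is needed. -/
theorem gronwall_of_forall_majorant {ι : Type*} {e : ι → ℝ → ℝ} {T A L K : ℝ} (hL : 0 ≤ L)
    (hA : 0 ≤ A) (hK : 0 ≤ K) (hbdd : ∀ i, ∀ t ∈ Icc 0 T, e i t ≤ K)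
    (hstep : ∀ φ : ℝ → ℝ, Continuous φ → (∀ s ∈ Icc 0 T, 0 ≤ φ s) →
      (∀ i, ∀ s ∈ Icc 0 T, e i s ≤ φ s) →
      ∀ i, ∀ t ∈ Icc 0 T, e i t ≤ A + L * ∫ s in (0 : ℝ)..t, φ s) :
    ∀ i, ∀ t ∈ Icc 0 T, e i t ≤ A * Real.exp (L * t) := by
  -- Each bound is a continuous majorant, so it may be fed back into `hstep`; integrating it raises
  -- `n` by one, and the last term tends to zero.
  have key : ∀ n : ℕ, ∀ i, ∀ t ∈ Icc 0 T,
      e i t ≤ A * Real.exp (L * t) + K * (L * t) ^ n / n.factorial := by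
    intro n
    induction n with
    | zero =>
      intro i t ht
      have := hbdd i t ht
      have h2 : 0 ≤ A * Real.exp (L * t) := by positivity
      simpa using by linarith
    | succ n ih =>
      intro i t ht
      have hc : Continuous fun t : ℝ => A * Real.exp (L * t) + K * (L * t) ^ n / n.factorial := by
        fun_prop
      refine (hstep _ hc (fun s hs => ?_) ih i t ht).trans (le_of_eq ?_)
      · have := hs.1
        positivity
      · have hd : ∀ s ∈ uIcc 0 t, HasDerivAt
            (fun s : ℝ => A * Real.exp (L * s) + K * (L * s) ^ (n + 1) / (n + 1).factorial)
            (L * (A * Real.exp (L * s) + K * (L * s) ^ n / n.factorial)) s := by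
          intro s _
          have h1 : HasDerivAt (fun s : ℝ => L * s) L s := by
            simpa using (hasDerivAt_id s).const_mul L
          have h2 := (h1.exp.const_mul A).add
            (((h1.pow (n + 1)).const_mul K).div_const ((n + 1).factorial : ℝ))
          refine h2.congr_deriv ?_
          have : ((n + 1).factorial : ℝ) = (n + 1) * n.factorial := by
            rw [Nat.factorial_succ]; push_cast; ring
          rw [this]
          have h3 : (n.factorial : ℝ) ≠ 0 := by positivity
          have h4 : (n + 1 : ℝ) ≠ 0 := by positivity
          push_cast
          field_simp
        have h5 := intervalIntegral.integral_eq_sub_of_hasDerivAt hd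
          ((continuous_const.mul hc).intervalIntegrable 0 t)
        rw [intervalIntegral.integral_const_mul] at h5
        rw [h5]
        simp
  intro i t ht
  have hlim : Tendsto (fun n : ℕ => A * Real.exp (L * t) + K * ((L * t) ^ n / n.factorial)) atTop
      (𝓝 (A * Real.exp (L * t) + K * 0)) :=
    ((FloorSemiring.tendsto_pow_div_factorial_atTop (L * t)).const_mul K).const_add _
  rw [mul_zero, add_zero] at hlim
  refine ge_of_tendsto' hlim fun n => ?_
  simpa only [mul_div_assoc] using key n i t ht

variable {E : Type*} [NormedAddCommGroup E] [NormedSpace ℝ E]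

/-- No integrability of `f` is needed: the integral of a non-integrable function is 0, which the
bound also covers. -/
theorem norm_intervalIntegral_le_of_majorant {f : ℝ → E} {φ : ℝ → ℝ} {t : ℝ} (ht : 0 ≤ t)
    (hφ : Continuous φ) (h : ∀ s ∈ Icc 0 t, ‖f s‖ ≤ φ s) :
    ‖∫ s in (0 : ℝ)..t, f s‖ ≤ ∫ s in (0 : ℝ)..t, φ s :=
  intervalIntegral.norm_integral_le_of_norm_le ht
    (Eventually.of_forall fun s hs => h s (Ioc_subset_Icc_self hs)) (hφ.intervalIntegrable _ _)

/-- Left-endpoint sums use only values at times in `[0,t]`; this is what makes time integrals of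
adapted processes adapted. Using `n + 1` pieces avoids division by zero. -/
theorem tendsto_riemannSum [CompleteSpace E] {g : ℝ → E} (hg : Continuous g) {t : ℝ} (ht : 0 ≤ t) :
    Tendsto (fun n : ℕ => ∑ k ∈ Finset.range (n + 1), (t / (n + 1)) • g (k * (t / (n + 1)))) atTop
      (𝓝 (∫ s in (0 : ℝ)..t, g s)) := by
  rw [Metric.tendsto_atTop]
  intro ε hε
  have huc : UniformContinuousOn g (Icc 0 t) :=
    isCompact_Icc.uniformContinuousOn_of_continuous hg.continuousOn
  rw [Metric.uniformContinuousOn_iff] at huc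
  -- Dividing by `t + 1` rather than `t` admits `t = 0` and makes the final inequality strict.
  obtain ⟨δ, hδ, hu⟩ := huc (ε / (t + 1)) (by positivity)
  obtain ⟨n₀, hn₀⟩ := exists_nat_gt (t / δ)
  refine ⟨n₀, fun n hn => ?_⟩
  set h : ℝ := t / (n + 1) with hh
  have hn1 : (0 : ℝ) < n + 1 := by positivity
  have hh0 : 0 ≤ h := by positivity
  have hhδ : h < δ := by
    rw [hh, div_lt_iff₀ hn1]
    rw [div_lt_iff₀ hδ] at hn₀
    have : (n₀ : ℝ) ≤ n := by exact_mod_cast hn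
    nlinarith
  have hsplit := intervalIntegral.sum_integral_adjacent_intervals (f := g) (μ := volume)
    (a := fun k : ℕ => (k : ℝ) * h) (n := n + 1) (fun k _ => hg.intervalIntegrable _ _)
  have hend : ((n + 1 : ℕ) : ℝ) * h = t := by
    rw [hh]; push_cast; field_simp
  rw [hend, Nat.cast_zero, zero_mul] at hsplit
  rw [← hsplit, dist_eq_norm, ← Finset.sum_sub_distrib]
  have hterm : ∀ k ∈ Finset.range (n + 1),
      ‖h • g (k * h) - ∫ s in (k : ℝ) * h..((k + 1 : ℕ) : ℝ) * h, g s‖ ≤ ε / (t + 1) * h := by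
    intro k hk
    have hk' : ((k + 1 : ℕ) : ℝ) ≤ ((n + 1 : ℕ) : ℝ) := by
      exact_mod_cast Finset.mem_range.1 hk
    have hle : (k : ℝ) * h ≤ ((k + 1 : ℕ) : ℝ) * h := by push_cast; nlinarith
    have hlen : ((k + 1 : ℕ) : ℝ) * h - k * h = h := by push_cast; ring
    have hc : h • g (k * h) = ∫ _ in (k : ℝ) * h..((k + 1 : ℕ) : ℝ) * h, g (k * h) := by
      rw [intervalIntegral.integral_const, hlen]
    rw [hc, ← intervalIntegral.integral_sub (by simp) (hg.intervalIntegrable _ _)]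
    refine (intervalIntegral.norm_integral_le_of_norm_le_const (C := ε / (t + 1)) ?_).trans ?_
    · intro s hs
      rw [uIoc_of_le hle] at hs
      have hub : ((k + 1 : ℕ) : ℝ) * h ≤ t := by
        rw [← hend]; exact mul_le_mul_of_nonneg_right hk' hh0
      have hk0 : 0 ≤ (k : ℝ) * h := by positivity
      rw [← dist_eq_norm]
      refine (hu _ ⟨hk0, hle.trans hub⟩ _ ⟨hk0.trans hs.1.le, hs.2.trans hub⟩ ?_).le
      rw [Real.dist_eq, abs_sub_comm, abs_of_nonneg (by linarith [hs.1])]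
      linarith [hs.2]
    · rw [hlen, abs_of_nonneg hh0]
  refine (norm_sum_le_of_le _ hterm).trans_lt ?_
  rw [Finset.sum_const, Finset.card_range, nsmul_eq_mul]
  calc ((n + 1 : ℕ) : ℝ) * (ε / (t + 1) * h) = ε / (t + 1) * (((n + 1 : ℕ) : ℝ) * h) := by ring
    _ = ε * (t / (t + 1)) := by rw [hend]; ring
    _ < ε * 1 := by
      refine mul_lt_mul_of_pos_left ?_ hε
      rw [div_lt_one (by linarith)]; linarith
    _ = ε := mul_one ε

end Calculus

/-! ### Adapted processes, random differential equations and continuous modifications. -/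

section Processes

open Filter Topology

/-- The null sets belong to the σ-algebra of `P`, not to `m`, so the limit is taken of the
`m`-measurable representatives. Where these diverge `limUnder` takes some default value, yet the
result stays `m`-measurable. -/
theorem MeasureTheory.AEStronglyMeasurable.of_tendsto_subalgebra {A E : Type*} {m₀ : MeasurableSpace A}
    {P : Measure[m₀] A} {m : MeasurableSpace A} [NormedAddCommGroup E] [CompleteSpace E]
    {f : ℕ → A → E} {g : A → E} (hf : ∀ n, AEStronglyMeasurable[m] (f n) P)
    (hlim : ∀ a, Tendsto (fun n => f n a) atTop (𝓝 (g a))) : AEStronglyMeasurable[m] g P := by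
  choose h hm he using hf
  refine ⟨fun a => limUnder atTop fun n => h n a, StronglyMeasurable.limUnder hm, ?_⟩
  filter_upwards [ae_all_iff.2 he] with a ha
  have : Tendsto (fun n => h n a) atTop (𝓝 (g a)) := by
    simpa only [← ha] using hlim a
  exact this.limUnder_eq.symm

theorem MeasureTheory.AEStronglyMeasurable.finset_sum_subalgebra {A E ι : Type*} {m₀ : MeasurableSpace A}
    {P : Measure[m₀] A} {m : MeasurableSpace A} [NormedAddCommGroup E] (s : Finset ι)
    {f : ι → A → E} (hf : ∀ i ∈ s, AEStronglyMeasurable[m] (f i) P) :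
    AEStronglyMeasurable[m] (fun a => ∑ i ∈ s, f i a) P := by
  classical
  induction s using Finset.induction_on with
  | empty => simpa using aestronglyMeasurable_const
  | insert i s hi ih =>
    simp only [Finset.sum_insert hi]
    exact (hf i (by simp)).add (ih fun j hj => hf j (by simp [hj]))

theorem MeasureTheory.AEStronglyMeasurable.intervalIntegral_adapted {A E : Type*} {m₀ : MeasurableSpace A}
    {P : Measure[m₀] A} {m : ℝ → MeasurableSpace A} (hm : Monotone m) [NormedAddCommGroup E]
    [NormedSpace ℝ E] [CompleteSpace E] {g : ℝ → A → E} (hg : ∀ a, Continuous fun s => g s a)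
    {t : ℝ} (ht : 0 ≤ t) (hmeas : ∀ s ∈ Icc 0 t, AEStronglyMeasurable[m s] (g s) P) :
    AEStronglyMeasurable[m t] (fun a => ∫ s in (0 : ℝ)..t, g s a) P := by
  refine AEStronglyMeasurable.of_tendsto_subalgebra (fun n => ?_)
    (fun a => tendsto_riemannSum (hg a) ht)
  refine AEStronglyMeasurable.finset_sum_subalgebra _ fun k hk => ?_
  have hk' : (k : ℝ) ≤ n + 1 := by
    exact_mod_cast (Finset.mem_range.1 hk).le
  have hle : (k : ℝ) * (t / (n + 1)) ≤ t := by
    rw [← mul_div_assoc, div_le_iff₀ (by positivity)]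
    nlinarith
  exact ((hmeas _ ⟨by positivity, hle⟩).mono (hm hle)).const_smul _

/-- Global solvability, with adapted solutions, of a random ordinary differential equation whose
vector field is bounded and uniformly Lipschitz. -/
theorem exists_adapted_ode_solution {A E : Type*} {m₀ : MeasurableSpace A}
    {P : Measure[m₀] A} {m : ℝ → MeasurableSpace A} (hm : Monotone m) [NormedAddCommGroup E]
    [NormedSpace ℝ E] [CompleteSpace E] {F : A → ℝ → E → E} {T : ℝ} (hT : 0 ≤ T) {L K : NNReal}
    (hcont : ∀ a, Continuous fun p : ℝ × E => F a p.1 p.2)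
    (hlip : ∀ a t, LipschitzWith K (F a t)) (hbdd : ∀ a t x, ‖F a t x‖ ≤ L)
    (hmeas : ∀ t ∈ Icc 0 T, ∀ u : A → E, AEStronglyMeasurable[m t] u P →
      AEStronglyMeasurable[m t] (fun a => F a t (u a)) P) :
    ∃ z : ℝ → A → E, (∀ t ∈ Icc 0 T, AEStronglyMeasurable[m t] (z t) P) ∧
      (∀ a, Continuous fun t => z t a) ∧
      ∀ a, ∀ t ∈ Icc 0 T, z t a = ∫ s in (0 : ℝ)..t, F a s (z s a) := by
  have hex : ∀ a, ∃ z : ℝ → E, Continuous z ∧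
      ∀ t ∈ Icc 0 T, z t = ∫ s in (0 : ℝ)..t, F a s (z s) := by
    intro a
    -- The field is bounded by `L`, so a trajectory from 0 stays in the ball of radius `L * T` and a
    -- single Picard–Lindelöf application covers all of `[0,T]`.
    have hpl : IsPicardLindelof (F a) (⟨0, le_rfl, hT⟩ : Icc 0 T) (0 : E) (L * T.toNNReal) 0 L K :=
      { lipschitzOnWith := fun t _ => (hlip a t).lipschitzOnWith
        continuousOn := fun x _ => by
          have := hcont a
          exact Continuous.continuousOn (by fun_prop)
        norm_le := fun t _ x _ => hbdd a t x
        mul_max_le := by simp [hT] }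
    obtain ⟨α, hα⟩ := ODE.FunSpace.exists_isFixedPt_next hpl (x := 0) (by simp)
    refine ⟨α.compProj, α.continuous_compProj, fun t ht => ?_⟩
    rw [ODE.FunSpace.isFixedPt_next_iff] at hα
    rw [ODE.FunSpace.compProj_of_mem ht]
    simpa using hα ⟨t, ht⟩
  choose z hzc hz using hex
  refine ⟨fun t a => z a t, ?_, hzc, hz⟩
  -- The solutions are chosen separately for each `a`, which says nothing about measurability. The
  -- Picard iterates are adapted by induction and converge to the chosen solution.
  let p : ℕ → ℝ → A → E := fun n => n.rec (fun _ _ => 0)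
    (fun _ q t a => ∫ s in (0 : ℝ)..t, F a s (q s a))
  have hp0 : ∀ t a, p 0 t a = 0 := fun _ _ => rfl
  have hps : ∀ n t a, p (n + 1) t a = ∫ s in (0 : ℝ)..t, F a s (p n s a) := fun _ _ _ => rfl
  have hpc : ∀ n a, Continuous fun t => p n t a := by
    intro n a
    induction n with
    | zero => exact continuous_const
    | succ n ih =>
      exact intervalIntegral.continuous_primitive
        (fun x y => ((hcont a).comp (continuous_id.prodMk ih)).intervalIntegrable x y) 0
  have hpF : ∀ n a, Continuous fun s => F a s (p n s a) := fun n a =>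
    (hcont a).comp (continuous_id.prodMk (hpc n a))
  have hzF : ∀ a, Continuous fun s => F a s (z a s) := fun a =>
    (hcont a).comp (continuous_id.prodMk (hzc a))
  have hpm : ∀ n, ∀ t ∈ Icc 0 T, AEStronglyMeasurable[m t] (p n t) P := by
    intro n
    induction n with
    | zero => intro t _; exact aestronglyMeasurable_const
    | succ n ih =>
      intro t ht
      exact AEStronglyMeasurable.intervalIntegral_adapted hm (hpF n) ht.1 fun s hs =>
        hmeas s ⟨hs.1, hs.2.trans ht.2⟩ _ (ih s ⟨hs.1, hs.2.trans ht.2⟩)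
  intro t ht
  refine AEStronglyMeasurable.of_tendsto_subalgebra (fun n => hpm n t ht) fun a => ?_
  -- The prefactor `L * T` bounds the distance of the solution from the zeroth iterate, which is 0.
  have hest : ∀ n, ∀ s ∈ Icc 0 T, ‖p n s a - z a s‖ ≤ L * T * (K * s) ^ n / n.factorial := by
    intro n
    induction n with
    | zero =>
      intro s hs
      rw [hp0, zero_sub, norm_neg, hz a s hs]
      refine (intervalIntegral.norm_integral_le_of_norm_le_const (C := L)
        (fun r _ => hbdd a r _)).trans ?_
      rw [sub_zero, abs_of_nonneg hs.1]
      simpa using mul_le_mul_of_nonneg_left hs.2 L.coe_nonneg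
    | succ n ih =>
      intro s hs
      rw [hps, hz a s hs, ← intervalIntegral.integral_sub ((hpF n a).intervalIntegrable _ _)
        ((hzF a).intervalIntegrable _ _)]
      refine (norm_intervalIntegral_le_of_majorant hs.1
        (φ := fun r => K * (L * T * (K * r) ^ n / n.factorial)) (by fun_prop) ?_).trans
        (le_of_eq ?_)
      · intro r hr
        have h1 := (hlip a r).dist_le_mul (p n r a) (z a r)
        rw [dist_eq_norm, dist_eq_norm] at h1
        exact h1.trans (mul_le_mul_of_nonneg_left (ih r ⟨hr.1, hr.2.trans hs.2⟩) K.coe_nonneg)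
      · have h3 : ∀ r : ℝ, (K : ℝ) * (L * T * (K * r) ^ n / n.factorial)
            = (K * (L * T * K ^ n / n.factorial)) * r ^ n := by
          intro r; rw [mul_pow]; ring
        simp only [h3]
        rw [intervalIntegral.integral_const_mul, integral_pow, Nat.factorial_succ]
        have h4 : (n.factorial : ℝ) ≠ 0 := by positivity
        have h5 : (n + 1 : ℝ) ≠ 0 := by positivity
        push_cast
        rw [mul_pow, zero_pow (by omega)]
        field_simp
        ring
  rw [tendsto_iff_norm_sub_tendsto_zero]
  refine squeeze_zero (fun _ => norm_nonneg _) (fun n => hest n t ht) ?_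
  have := (FloorSemiring.tendsto_pow_div_factorial_atTop ((K : ℝ) * t)).const_mul ((L : ℝ) * T)
  simpa only [mul_zero, mul_div_assoc] using this

/-- A process with almost surely continuous paths on `[0,T]` has a jointly measurable modification
all of whose paths are continuous; it can be chosen to vanish off any given almost sure event. -/
theorem exists_continuous_modification {A E : Type*} {m₀ : MeasurableSpace A} {P : Measure A}
    [TopologicalSpace E] [TopologicalSpace.PseudoMetrizableSpace E] [Zero E] {f : ℝ → A → E}
    {T : ℝ} (hT : 0 ≤ T) (hmeas : ∀ t ∈ Icc 0 T, AEStronglyMeasurable (f t) P)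
    (hcont : ∀ᵐ a ∂P, ContinuousOn (fun t => f t a) (Icc 0 T)) {p : A → Prop}
    (hp : ∀ᵐ a ∂P, p a) :
    ∃ g : ℝ → A → E, (∀ a, Continuous fun t => g t a) ∧ (∀ t, StronglyMeasurable (g t)) ∧
      (∀ᵐ a ∂P, ∀ t ∈ Icc 0 T, g t a = f t a) ∧
      ∀ a, (∀ t, g t a = 0) ∨ (p a ∧ ∀ t, g t a = f (projIcc 0 T hT t) a) := by
  classical
  -- Countably many times suffice to have one null set off which the process agrees with measurable
  -- representatives; continuity then determines the remaining times.
  obtain ⟨D, hDc, hDd⟩ := TopologicalSpace.exists_countable_dense (Icc (0 : ℝ) T)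
  choose h hm he using fun q : Icc (0 : ℝ) T => hmeas q q.2
  have hgood : ∀ᵐ a ∂P, ContinuousOn (fun t => f t a) (Icc 0 T) ∧ p a ∧
      ∀ q ∈ D, f q a = h q a := by
    filter_upwards [hcont, hp, (ae_ball_iff hDc).2 fun q _ => he q] with a h1 h2 h3
    exact ⟨h1, h2, h3⟩
  -- The exceptional set is enlarged to a measurable null set. The modification is 0 on it, and
  -- elsewhere `f` with time clamped to `[0,T]`.
  obtain ⟨S, hS, hSm, hS0⟩ := exists_measurable_superset_of_null (ae_iff.1 hgood)
  have hout : ∀ a, a ∉ S → ContinuousOn (fun t => f t a) (Icc 0 T) ∧ p a ∧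
      ∀ q ∈ D, f q a = h q a := fun a ha => by
    by_contra hcon
    exact ha (hS hcon)
  have hin : ∀ a, a ∉ S → ∀ t ∈ Icc 0 T,
      Sᶜ.indicator (f (projIcc 0 T hT t)) a = f t a := by
    intro a ha t ht
    rw [indicator_of_mem (by simpa using ha), projIcc_of_mem hT ht]
  have hgc : ∀ a, Continuous fun t => Sᶜ.indicator (f (projIcc 0 T hT t)) a := by
    intro a
    by_cases ha : a ∈ S
    · simpa [ha] using continuous_const
    · simp only [indicator_of_mem (show a ∈ Sᶜ from ha)]
      exact ((continuousOn_iff_continuous_domRestrict.1 (hout a ha).1).comp continuous_projIcc)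
  refine ⟨fun t => Sᶜ.indicator (f (projIcc 0 T hT t)), hgc, ?_, ?_, ?_⟩
  · intro t
    obtain ⟨q, hqD, hq⟩ := mem_closure_iff_seq_limit.1 (hDd (projIcc 0 T hT t))
    refine stronglyMeasurable_of_tendsto (f := fun n => Sᶜ.indicator (h (q n))) atTop
      (fun n => (hm _).indicator hSm.compl) (tendsto_pi_nhds.2 fun a => ?_)
    by_cases ha : a ∈ S
    · simpa [ha] using tendsto_const_nhds
    · simp only [indicator_of_mem (show a ∈ Sᶜ from ha)]
      have := ((continuousOn_iff_continuous_domRestrict.1 (hout a ha).1).tendsto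
        (projIcc 0 T hT t)).comp hq
      refine this.congr fun n => ?_
      exact (hout a ha).2.2 _ (hqD n)
  · have : ∀ᵐ a ∂P, a ∉ S := measure_eq_zero_iff_ae_notMem.1 hS0
    filter_upwards [this] with a ha using hin a ha
  · intro a
    by_cases ha : a ∈ S
    · left; intro t; simp [ha]
    · exact Or.inr ⟨(hout a ha).2.1, fun t => indicator_of_mem (show a ∈ Sᶜ from ha) _⟩

end Processes

/-! ### The projection onto the state space. -/

section StateSpaceGeometry

variable {d : ℕ} {k : StateSpaceKind}

/-- Through this contraction the Euclidean space and the torus are handled together: differences of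
states are projections of differences of displacements. -/
theorem StateSpace.norm_proj_le (v : EuclideanSpace ℝ (Fin d)) : ‖StateSpace.proj d k v‖ ≤ ‖v‖ := by
  cases k with
  | euclidean => exact le_rfl
  | torus => exact QuotientAddGroup.norm_mk_le_norm

theorem StateSpace.continuous_proj : Continuous (StateSpace.proj d k) :=
  AddMonoidHomClass.continuous_of_bound (StateSpace.proj d k) 1 fun v => by
    simpa using StateSpace.norm_proj_le v

end StateSpaceGeometry

/-! ### Continuity of the coefficients. -/

namespace Coefficients.IsRegular

variable {d : ℕ} {k : StateSpaceKind} {c : Coefficients d k} {M : ℝ}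

theorem nonneg (hc : c.IsRegular M) : 0 ≤ M := (abs_nonneg _).trans (hc.α_bound 0 0)

theorem continuous_μ (hc : c.IsRegular M) : Continuous c.μ :=
  (LipschitzWith.of_dist_le_mul (K := ⟨M, hc.nonneg⟩) fun x y => by
    rw [dist_eq_norm]; exact hc.μ_lip x y).continuous

theorem continuous_of_lipschitz_pair {E F : Type*} [PseudoMetricSpace E] [SeminormedAddCommGroup F]
    {f : E → E → F} (hM : 0 ≤ M)
    (hf : ∀ x x' y y', ‖f x y - f x' y'‖ ≤ M * (dist x x' + dist y y')) :
    Continuous fun p : E × E => f p.1 p.2 := by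
  refine (LipschitzWith.of_dist_le_mul (K := ⟨2 * M, by positivity⟩) fun p q => ?_).continuous
  rw [dist_eq_norm]
  refine (hf _ _ _ _).trans ?_
  have h1 : dist p.1 q.1 ≤ dist p q := le_max_left _ _
  have h2 : dist p.2 q.2 ≤ dist p q := le_max_right _ _
  change _ ≤ 2 * M * dist p q
  nlinarith

theorem continuous_σ (hc : c.IsRegular M) :
    Continuous fun p : StateSpace d k × StateSpace d k => c.σ p.1 p.2 :=
  continuous_of_lipschitz_pair hc.nonneg hc.σ_lip

theorem continuous_α (hc : c.IsRegular M) :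
    Continuous fun p : StateSpace d k × StateSpace d k => c.α p.1 p.2 :=
  continuous_of_lipschitz_pair hc.nonneg hc.α_lip

theorem continuous_β (hc : c.IsRegular M) :
    Continuous fun p : StateSpace d k × StateSpace d k => c.β p.1 p.2 :=
  continuous_of_lipschitz_pair hc.nonneg hc.β_lip

end Coefficients.IsRegular

/-! ### Drift estimates and the a priori weight bound. -/

section Drifts

variable {d : ℕ} {k : StateSpaceKind} {c : Coefficients d k} {M : ℝ} {N : ℕ}

/-- The drift of the `i`-th agent. -/
def agentDrift (c : Coefficients d k) (x : Fin N → StateSpace d k) (w : Fin N → Fin N → ℝ)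
    (i : Fin N) : EuclideanSpace ℝ (Fin d) :=
  c.μ (x i) + (N : ℝ)⁻¹ • ∑ j ∈ Finset.univ.erase i, w i j • c.σ (x i) (x j)

/-- The drift of a weight between two agents. -/
def weightDrift (c : Coefficients d k) (x y : StateSpace d k) (w : ℝ) : ℝ :=
  c.α x y * w + c.β x y

/-- There are `N - 1` terms against the factor `1/N`, hence the need for `0 ≤ q`. -/
theorem average_erase_le {f : Fin N → ℝ} {q : ℝ} (hq : 0 ≤ q) (i : Fin N)
    (hf : ∀ j, j ≠ i → f j ≤ q) : (N : ℝ)⁻¹ * ∑ j ∈ Finset.univ.erase i, f j ≤ q := by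
  have hN : (0 : ℝ) < N := by exact_mod_cast i.pos
  have h1 : ∑ j ∈ Finset.univ.erase i, f j ≤ N * q := by
    refine (Finset.sum_le_card_nsmul _ _ q fun j hj => hf j (Finset.ne_of_mem_erase hj)).trans ?_
    rw [nsmul_eq_mul]
    refine mul_le_mul_of_nonneg_right ?_ hq
    exact_mod_cast (Finset.card_le_univ _).trans (by simp)
  rw [inv_mul_le_iff₀ hN]
  exact h1

theorem norm_inv_smul_sum_erase_le {E : Type*} [NormedAddCommGroup E] [NormedSpace ℝ E]
    (i : Fin N) (f : Fin N → E) :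
    ‖(N : ℝ)⁻¹ • ∑ j ∈ Finset.univ.erase i, f j‖
      ≤ (N : ℝ)⁻¹ * ∑ j ∈ Finset.univ.erase i, ‖f j‖ := by
  rw [norm_smul, Real.norm_of_nonneg (by positivity)]
  exact mul_le_mul_of_nonneg_left (norm_sum_le _ _) (by positivity)

/-- The splitting is asymmetric: only the weight `v` of one system has to be bounded. -/
theorem norm_weighted_sub_le {E : Type*} [NormedAddCommGroup E] [NormedSpace ℝ E] {f g : E}
    {u v V D : ℝ} (hf : ‖f‖ ≤ M) (hfg : ‖f - g‖ ≤ M * D) (hv : |v| ≤ V) :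
    ‖u • f - v • g‖ ≤ M * |u - v| + V * (M * D) := by
  have h : u • f - v • g = (u - v) • f + v • (f - g) := by module
  rw [h]
  refine (norm_add_le _ _).trans ?_
  rw [norm_smul, norm_smul, Real.norm_eq_abs, Real.norm_eq_abs, mul_comm M]
  exact add_le_add (mul_le_mul_of_nonneg_left hf (abs_nonneg _))
    (mul_le_mul hv hfg (norm_nonneg _) ((abs_nonneg _).trans hv))

/-- The sum over `j` is kept because the L¹ comparison has bounds only on each expectation, not
pointwise uniform ones. -/
theorem norm_agentDrift_sub_le (hc : c.IsRegular M) {V : ℝ} {x y : Fin N → StateSpace d k}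
    {w v : Fin N → Fin N → ℝ} (i : Fin N) (hv : ∀ j, j ≠ i → |v i j| ≤ V) :
    ‖agentDrift c x w i - agentDrift c y v i‖ ≤ M * ‖x i - y i‖
      + (N : ℝ)⁻¹ * ∑ j ∈ Finset.univ.erase i,
        (M * |w i j - v i j| + V * (M * (‖x i - y i‖ + ‖x j - y j‖))) := by
  unfold agentDrift
  rw [add_sub_add_comm, ← smul_sub, ← Finset.sum_sub_distrib]
  refine (norm_add_le _ _).trans (add_le_add ?_ ?_)
  · rw [← dist_eq_norm (x i)]; exact hc.μ_lip _ _
  · refine (norm_inv_smul_sum_erase_le i _).trans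
      (mul_le_mul_of_nonneg_left (Finset.sum_le_sum fun j hj => ?_) (by positivity))
    refine norm_weighted_sub_le (hc.σ_bound _ _) ?_ (hv j (Finset.ne_of_mem_erase hj))
    rw [← dist_eq_norm (x i), ← dist_eq_norm (x j)]
    exact hc.σ_lip _ _ _ _

theorem norm_agentDrift_sub_le_of_le (hc : c.IsRegular M) {V r : ℝ} (hV : 0 ≤ V) (hr : 0 ≤ r)
    {x y : Fin N → StateSpace d k} {w v : Fin N → Fin N → ℝ} (i : Fin N)
    (hv : ∀ j, j ≠ i → |v i j| ≤ V) (hx : ∀ j, ‖x j - y j‖ ≤ r)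
    (hw : ∀ j, j ≠ i → |w i j - v i j| ≤ r) :
    ‖agentDrift c x w i - agentDrift c y v i‖ ≤ (2 * M + 2 * V * M) * r := by
  have hM := hc.nonneg
  refine (norm_agentDrift_sub_le hc i hv).trans ?_
  have h1 := average_erase_le (q := (M + 2 * V * M) * r) (by positivity) i
    (f := fun j => M * |w i j - v i j| + V * (M * (‖x i - y i‖ + ‖x j - y j‖))) fun j hj => by
      have h2 := mul_le_mul_of_nonneg_left (hw j hj) hM
      have h3 := mul_le_mul_of_nonneg_left (add_le_add (hx i) (hx j)) (mul_nonneg hV hM)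
      linarith
  have h4 := mul_le_mul_of_nonneg_left (hx i) hM
  linarith

theorem norm_agentDrift_le (hc : c.IsRegular M) {V : ℝ} (hV : 0 ≤ V) {x : Fin N → StateSpace d k}
    {w : Fin N → Fin N → ℝ} (i : Fin N) (hw : ∀ j, j ≠ i → |w i j| ≤ V) :
    ‖agentDrift c x w i‖ ≤ M + V * M := by
  have hM := hc.nonneg
  refine (norm_add_le _ _).trans (add_le_add (hc.μ_bound _) ?_)
  refine (norm_inv_smul_sum_erase_le i _).trans
    (average_erase_le (mul_nonneg hV hM) i fun j hj => ?_)
  rw [norm_smul]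
  exact mul_le_mul (hw j hj) (hc.σ_bound _ _) (norm_nonneg _) hV

theorem abs_weightDrift_sub_le (hc : c.IsRegular M) {V : ℝ} {x y x' y' : StateSpace d k}
    {w v : ℝ} (hv : |v| ≤ V) :
    |weightDrift c x x' w - weightDrift c y y' v|
      ≤ M * |w - v| + (V * M + M) * (‖x - y‖ + ‖x' - y'‖) := by
  unfold weightDrift
  have h1 : ‖w • c.α x x' - v • c.α y y'‖ ≤ _ :=
    norm_weighted_sub_le (hc.α_bound x x') (hc.α_lip x y x' y') hv
  have h2 := hc.β_lip x y x' y'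
  rw [Real.norm_eq_abs, smul_eq_mul, smul_eq_mul, dist_eq_norm, dist_eq_norm] at h1
  rw [dist_eq_norm, dist_eq_norm] at h2
  have h3 : c.α x x' * w + c.β x x' - (c.α y y' * v + c.β y y')
      = (w * c.α x x' - v * c.α y y') + (c.β x x' - c.β y y') := by ring
  rw [h3]
  refine (abs_add_le _ _).trans ?_
  linarith

theorem abs_weightDrift_le (hc : c.IsRegular M) (x y : StateSpace d k) (w : ℝ) :
    |weightDrift c x y w| ≤ M * |w| + M := by
  unfold weightDrift
  refine (abs_add_le _ _).trans (add_le_add ?_ (hc.β_bound _ _))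
  rw [abs_mul]
  exact mul_le_mul_of_nonneg_right (hc.α_bound _ _) (abs_nonneg _)

theorem continuous_agentDrift (hc : c.IsRegular M) :
    Continuous fun p : (Fin N → StateSpace d k) × (Fin N → Fin N → ℝ) =>
      fun i => agentDrift c p.1 p.2 i := by
  have h1 := hc.continuous_μ
  have h2 := hc.continuous_σ
  refine continuous_pi fun i => ?_
  unfold agentDrift
  have h3 : ∀ j, Continuous fun p : (Fin N → StateSpace d k) × (Fin N → Fin N → ℝ) =>
      c.σ (p.1 i) (p.1 j) := fun j =>
    h2.comp (by fun_prop : Continuous fun p : (Fin N → StateSpace d k) × (Fin N → Fin N → ℝ) =>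
      (p.1 i, p.1 j))
  fun_prop

theorem continuous_weightDrift (hc : c.IsRegular M) :
    Continuous fun p : StateSpace d k × StateSpace d k × ℝ => weightDrift c p.1 p.2.1 p.2.2 := by
  unfold weightDrift
  exact ((hc.continuous_α.comp (by fun_prop : Continuous fun p : StateSpace d k ×
    StateSpace d k × ℝ => (p.1, p.2.1))).mul (by fun_prop)).add
    (hc.continuous_β.comp (by fun_prop : Continuous fun p : StateSpace d k ×
    StateSpace d k × ℝ => (p.1, p.2.1)))

/-- An a priori bound on `[0,T]` for weights with initial values in `[-M,M]`. -/
def weightBound (M T : ℝ) : ℝ := (M + M * T) * Real.exp (M * T)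

theorem weightBound_nonneg {T : ℝ} (hM : 0 ≤ M) (hT : 0 ≤ T) : 0 ≤ weightBound M T := by
  unfold weightBound; positivity

/-- Grönwall for affine growth. The factor `M + M * T` collects the initial value and the time
integral of the constant part of the growth bound. -/
theorem abs_le_weightBound {w g : ℝ → ℝ} {T w₀ : ℝ} (hM : 0 ≤ M)
    (hw : ContinuousOn w (Icc 0 T)) (h0 : |w₀| ≤ M)
    (heq : ∀ t ∈ Icc 0 T, w t = w₀ + ∫ s in (0 : ℝ)..t, g s)
    (hg : ∀ s ∈ Icc 0 T, |g s| ≤ M * |w s| + M) {t : ℝ} (ht : t ∈ Icc 0 T) :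
    |w t| ≤ weightBound M T := by
  have hT : 0 ≤ T := ht.1.trans ht.2
  obtain ⟨K, hK⟩ := (isCompact_Icc.exists_bound_of_continuousOn hw)
  have h := gronwall_of_forall_majorant (ι := Unit) (e := fun _ t => |w t|) (T := T)
    (A := M + M * T) (L := M) (K := K) hM (by positivity) ((norm_nonneg _).trans (hK t ht))
    (fun _ t ht => hK t ht) (fun φ hφ _ hwφ _ t ht => ?_) () t ht
  · refine h.trans (mul_le_mul_of_nonneg_left (Real.exp_le_exp.2 ?_) (by positivity))
    exact mul_le_mul_of_nonneg_left ht.2 hM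
  · have h1 := norm_intervalIntegral_le_of_majorant (f := g) (φ := fun s => M * φ s + M) ht.1
      (by fun_prop) fun s hs => by
        have hs' : s ∈ Icc 0 T := ⟨hs.1, hs.2.trans ht.2⟩
        have := mul_le_mul_of_nonneg_left (hwφ () s hs') hM
        exact (hg s hs').trans (by linarith)
    rw [intervalIntegral.integral_add ((hφ.const_mul M).intervalIntegrable _ _) (by simp),
      intervalIntegral.integral_const_mul, intervalIntegral.integral_const, Real.norm_eq_abs,
      smul_eq_mul, sub_zero] at h1
    rw [heq t ht]
    refine (abs_add_le _ _).trans ?_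
    have := mul_le_mul_of_nonneg_right ht.2 hM
    linarith

end Drifts

/-! ### Uniqueness of a single realization. -/

section Paths

variable {d : ℕ} {k : StateSpaceKind} {c : Coefficients d k} {M : ℝ} {N : ℕ}

/-- A realization of the `N`-agent system on `[0,T]` driven by the noise path `b`. -/
structure IsAgentPath (c : Coefficients d k) (T : ℝ) (b : Fin N → ℝ → EuclideanSpace ℝ (Fin d))
    (x : Fin N → ℝ → StateSpace d k) (w : Fin N → Fin N → ℝ → ℝ) : Prop where
  x_continuous : ∀ i, ContinuousOn (x i) (Icc 0 T)
  w_continuous : ∀ i j, i ≠ j → ContinuousOn (w i j) (Icc 0 T)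
  x_eq : ∀ i, ∀ t ∈ Icc 0 T, x i t = x i 0 + StateSpace.proj d k
    ((∫ s in (0 : ℝ)..t, agentDrift c (fun j => x j s) (fun j l => w j l s) i) + c.ν • b i t)
  w_eq : ∀ i j, i ≠ j → ∀ t ∈ Icc 0 T, w i j t = w i j 0
    + ∫ s in (0 : ℝ)..t, weightDrift c (x i s) (x j s) (w i j s)

theorem continuousOn_agentDrift (hc : c.IsRegular M) {S : Set ℝ}
    {x : Fin N → ℝ → StateSpace d k} {w : Fin N → Fin N → ℝ → ℝ} (hx : ∀ i, ContinuousOn (x i) S)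
    (hw : ∀ i j, i ≠ j → ContinuousOn (w i j) S) (i : Fin N) :
    ContinuousOn (fun s => agentDrift c (fun j => x j s) (fun j l => w j l s) i) S := by
  unfold agentDrift
  have h : ContinuousOn (fun s => ∑ j ∈ Finset.univ.erase i, w i j s • c.σ (x i s) (x j s)) S :=
    continuousOn_finsetSum _ fun j hj => ContinuousOn.smul
      (hw i j (Finset.ne_of_mem_erase hj).symm)
      (hc.continuous_σ.comp_continuousOn ((hx i).prodMk (hx j)))
  exact (hc.continuous_μ.comp_continuousOn (hx i)).add (h.const_smul (N : ℝ)⁻¹)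

theorem continuousOn_weightDrift (hc : c.IsRegular M) {S : Set ℝ}
    {x y : ℝ → StateSpace d k} {w : ℝ → ℝ} (hx : ContinuousOn x S) (hy : ContinuousOn y S)
    (hw : ContinuousOn w S) : ContinuousOn (fun s => weightDrift c (x s) (y s) (w s)) S :=
  (continuous_weightDrift hc).comp_continuousOn (hx.prodMk (hy.prodMk hw))

theorem ContinuousOn.intervalIntegrable_zero {E : Type*} [NormedAddCommGroup E] {f : ℝ → E}
    {T t : ℝ} (hf : ContinuousOn f (Icc 0 T)) (ht : t ∈ Icc 0 T) :
    IntervalIntegrable f volume 0 t :=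
  (hf.mono (by rw [uIcc_of_le ht.1]; exact Icc_subset_Icc_right ht.2)).intervalIntegrable

/-- The noise cancels in the difference, leaving a Lipschitz integral inequality with zero initial
error. No bound on the initial weights is assumed: continuity on a compact interval bounds the
finitely many weights of one path. -/
theorem IsAgentPath.unique (hc : c.IsRegular M) {T : ℝ}
    {b : Fin N → ℝ → EuclideanSpace ℝ (Fin d)} {x y : Fin N → ℝ → StateSpace d k}
    {w v : Fin N → Fin N → ℝ → ℝ} (hxw : IsAgentPath c T b x w) (hyv : IsAgentPath c T b y v)
    (h0 : ∀ i, x i 0 = y i 0) (h0' : ∀ i j, i ≠ j → w i j 0 = v i j 0) :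
    ∀ t ∈ Icc 0 T, (∀ i, x i t = y i t) ∧ ∀ i j, i ≠ j → w i j t = v i j t := by
  classical
  have hM := hc.nonneg
  have hbv : ∃ V : ℝ, 0 ≤ V ∧ ∀ i j, i ≠ j → ∀ t ∈ Icc 0 T, |v i j t| ≤ V := by
    have : ∀ p : Fin N × Fin N, ∃ V : ℝ, p.1 ≠ p.2 → ∀ t ∈ Icc 0 T, |v p.1 p.2 t| ≤ V := by
      intro p
      by_cases hp : p.1 = p.2
      · exact ⟨0, fun h => absurd hp h⟩
      · obtain ⟨V, hV⟩ := isCompact_Icc.exists_bound_of_continuousOn (hyv.w_continuous _ _ hp)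
        exact ⟨V, fun _ => hV⟩
    choose V hV using this
    refine ⟨∑ p, |V p|, Finset.sum_nonneg fun p _ => abs_nonneg _, fun i j hij t ht => ?_⟩
    exact ((hV (i, j) hij t ht).trans (le_abs_self _)).trans
      (Finset.single_le_sum (f := fun p => |V p|) (fun p _ => abs_nonneg _) (Finset.mem_univ (i, j)))
  obtain ⟨V, hV0, hV⟩ := hbv
  -- Since nothing is known about diagonal weights, their error is set to 0.
  let e : Fin N ⊕ Fin N × Fin N → ℝ → ℝ := fun q t =>
    q.elim (fun i => ‖x i t - y i t‖) (fun p => if p.1 = p.2 then 0 else |w p.1 p.2 t - v p.1 p.2 t|)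
  have hec : ∀ q, ContinuousOn (e q) (Icc 0 T) := by
    rintro (i | ⟨i, j⟩)
    · exact ((hxw.x_continuous i).sub (hyv.x_continuous i)).norm
    · by_cases hij : i = j
      · simpa [e, hij] using continuousOn_const
      · simpa [e, hij] using ((hxw.w_continuous i j hij).sub (hyv.w_continuous i j hij)).abs
  have hbd : ∃ K : ℝ, 0 ≤ K ∧ ∀ q, ∀ t ∈ Icc 0 T, e q t ≤ K := by
    choose K hK using fun q => isCompact_Icc.exists_bound_of_continuousOn (hec q)
    refine ⟨∑ q, |K q|, Finset.sum_nonneg fun p _ => abs_nonneg _, fun q t ht => ?_⟩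
    exact ((le_abs_self _).trans ((hK q t ht).trans (le_abs_self _))).trans
      (Finset.single_le_sum (f := fun p => |K p|) (fun p _ => abs_nonneg _) (Finset.mem_univ q))
  obtain ⟨K, hK0, hK⟩ := hbd
  -- This rate dominates both the state rate `2 * M + 2 * V * M` and the weight rate `M + 2 * (V * M
  -- + M)`.
  have hL : 0 ≤ 3 * M + 2 * V * M := by positivity
  have key := gronwall_of_forall_majorant (e := e) (T := T) (A := 0) (L := 3 * M + 2 * V * M)
    hL le_rfl hK0 hK ?_
  · intro t ht
    refine ⟨fun i => ?_, fun i j hij => ?_⟩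
    · have := key (Sum.inl i) t ht
      rw [zero_mul] at this
      exact sub_eq_zero.1 (norm_le_zero_iff.1 this)
    · have := key (Sum.inr (i, j)) t ht
      simp only [e, Sum.elim_inr, if_neg hij, zero_mul] at this
      exact sub_eq_zero.1 (abs_nonpos_iff.1 this)
  · intro φ hφ hφ0 heφ q t ht
    have hx : ∀ s ∈ Icc 0 T, ∀ i, ‖x i s - y i s‖ ≤ φ s := fun s hs i => heφ (Sum.inl i) s hs
    have hw : ∀ s ∈ Icc 0 T, ∀ i j, i ≠ j → |w i j s - v i j s| ≤ φ s := fun s hs i j hij => by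
      simpa [e, hij] using heφ (Sum.inr (i, j)) s hs
    have hsub : ∀ s ∈ Icc 0 t, s ∈ Icc 0 T := fun s hs => ⟨hs.1, hs.2.trans ht.2⟩
    have hL' : ∀ s ∈ Icc 0 T, 0 ≤ M * φ s := fun s hs => mul_nonneg hM (hφ0 s hs)
    rw [zero_add, ← intervalIntegral.integral_const_mul]
    rcases q with i | ⟨i, j⟩
    · have h1 : x i t - y i t = StateSpace.proj d k (∫ s in (0 : ℝ)..t,
          (agentDrift c (fun j => x j s) (fun j l => w j l s) i
            - agentDrift c (fun j => y j s) (fun j l => v j l s) i)) := by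
        rw [intervalIntegral.integral_sub
          ((continuousOn_agentDrift hc hxw.x_continuous hxw.w_continuous i).intervalIntegrable_zero
            ht)
          ((continuousOn_agentDrift hc hyv.x_continuous hyv.w_continuous i).intervalIntegrable_zero
            ht), hxw.x_eq i t ht, hyv.x_eq i t ht, h0 i, add_sub_add_left_eq_sub, ← map_sub,
          add_sub_add_right_eq_sub]
      simp only [e, Sum.elim_inl]
      rw [h1]
      refine (StateSpace.norm_proj_le _).trans
        (norm_intervalIntegral_le_of_majorant ht.1 (by fun_prop) fun s hs => ?_)
      have hs' := hsub s hs
      refine (norm_agentDrift_sub_le_of_le hc hV0 (hφ0 s hs') i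
        (fun j hj => hV i j hj.symm s hs') (hx s hs')
        (fun j hj => hw s hs' i j hj.symm)).trans ?_
      linarith [hL' s hs']
    · by_cases hij : i = j
      · simp only [e, Sum.elim_inr, if_pos hij]
        refine intervalIntegral.integral_nonneg ht.1 fun s hs => ?_
        exact mul_nonneg hL (hφ0 s (hsub s hs))
      · have h1 : w i j t - v i j t = ∫ s in (0 : ℝ)..t,
            (weightDrift c (x i s) (x j s) (w i j s) - weightDrift c (y i s) (y j s) (v i j s)) := by
          rw [intervalIntegral.integral_sub
            ((continuousOn_weightDrift hc (hxw.x_continuous i) (hxw.x_continuous j)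
              (hxw.w_continuous i j hij)).intervalIntegrable_zero ht)
            ((continuousOn_weightDrift hc (hyv.x_continuous i) (hyv.x_continuous j)
              (hyv.w_continuous i j hij)).intervalIntegrable_zero ht),
            hxw.w_eq i j hij t ht, hyv.w_eq i j hij t ht, h0' i j hij, add_sub_add_left_eq_sub]
        simp only [e, Sum.elim_inr, if_neg hij]
        rw [h1]
        rw [← Real.norm_eq_abs]
        refine norm_intervalIntegral_le_of_majorant (φ := fun s => (3 * M + 2 * V * M) * φ s) ht.1
          (by fun_prop) fun s hs => ?_
        rw [Real.norm_eq_abs]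
        have hs' := hsub s hs
        refine (abs_weightDrift_sub_le hc (hV i j hij s hs')).trans ?_
        have h2 := mul_le_mul_of_nonneg_left (hw s hs' i j hij) hM
        have h3 := mul_le_mul_of_nonneg_left (add_le_add (hx s hs' i) (hx s hs' j))
          (by positivity : 0 ≤ V * M + M)
        linarith

end Paths

/-! ### Resampling coordinates of product measures. -/

section ProductMeasures

/-- Two roles are separated: measurability of `φ` is for the σ-algebras of known events, while null
sets are transported by the measures on the full ones. -/
theorem MeasureTheory.AEStronglyMeasurable.comp_quasiMeasurePreserving_subalgebra {A B E : Type*}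
    {mA : MeasurableSpace A} {mB : MeasurableSpace B} {P : Measure[mA] A} {R : Measure[mB] B}
    {mA' : MeasurableSpace A} {mB' : MeasurableSpace B} [TopologicalSpace E] {f : B → E} {φ : A → B}
    (hf : AEStronglyMeasurable[mB'] f R) (hφ : Measurable[mA', mB'] φ)
    (hq : Measure.QuasiMeasurePreserving φ P R) :
    AEStronglyMeasurable[mA'] (fun a => f (φ a)) P := by
  obtain ⟨g, hg, he⟩ := hf
  exact ⟨fun a => g (φ a), hg.comp_measurable hφ, hq.ae_eq he⟩

variable {ι α : Type*} [Fintype ι] [DecidableEq ι] [MeasurableSpace α]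

/-- Resampling one coordinate of a product of probability measures preserves the product. -/
theorem measurePreserving_update_pi (P : ι → Measure α) [∀ i, IsProbabilityMeasure (P i)] (j : ι) :
    MeasurePreserving (fun p : (ι → α) × α => Function.update p.1 j p.2)
      ((Measure.pi P).prod (P j)) (Measure.pi P) := by
  have hm : Measurable fun p : (ι → α) × α => Function.update p.1 j p.2 := by
    refine measurable_pi_lambda _ fun l => ?_
    by_cases hl : l = j
    · subst hl; simpa using measurable_snd
    · simp only [Function.update_of_ne hl]
      exact (measurable_pi_apply l).comp measurable_fst
  refine ⟨hm, (Measure.pi_eq fun s hs => ?_).symm⟩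
  rw [Measure.map_apply hm (MeasurableSet.univ_pi hs)]
  have : (fun p : (ι → α) × α => Function.update p.1 j p.2) ⁻¹' (Set.univ.pi s)
      = (Set.univ.pi (Function.update s j Set.univ)) ×ˢ s j := by
    ext ⟨a, b⟩
    simp only [mem_preimage, mem_pi, mem_univ, true_imp_iff, mem_prod]
    constructor
    · intro h
      refine ⟨fun l => ?_, by simpa using h j⟩
      by_cases hl : l = j
      · subst hl; simp
      · simpa [Function.update_of_ne hl] using h l
    · rintro ⟨h, hb⟩ l
      by_cases hl : l = j
      · subst hl; simpa using hb
      · simpa [Function.update_of_ne hl] using h l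
  rw [this, Measure.prod_prod, Measure.pi_pi, ← Finset.mul_prod_erase _ _ (Finset.mem_univ j),
    ← Finset.mul_prod_erase Finset.univ (fun i => P i (s i)) (Finset.mem_univ j)]
  have h2 : ∀ l ∈ Finset.univ.erase j, P l (Function.update s j Set.univ l) = P l (s l) := by
    intro l hl
    rw [Function.update_of_ne (Finset.ne_of_mem_erase hl)]
  rw [Finset.prod_congr rfl h2]
  simp [mul_comm]

/-- After resampling coordinate `j`, the pair consists of coordinate `i` and an independent fresh
sample. -/
theorem measurePreserving_eval_pair (P : ι → Measure α) [∀ i, IsProbabilityMeasure (P i)] {i j : ι}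
    (hij : i ≠ j) :
    MeasurePreserving (fun a : ι → α => (a i, a j)) (Measure.pi P) ((P i).prod (P j)) := by
  have hm : Measurable fun a : ι → α => (a i, a j) := by fun_prop
  refine ⟨hm, ?_⟩
  have h1 : MeasurePreserving (fun p : (ι → α) × α => (p.1 i, p.2)) ((Measure.pi P).prod (P j))
      ((P i).prod (P j)) := (measurePreserving_eval P i).prod (MeasurePreserving.id (P j))
  rw [← (measurePreserving_update_pi P j).map_eq, Measure.map_map hm
    (measurePreserving_update_pi P j).measurable]
  have h2 : (fun a : ι → α => (a i, a j)) ∘ (fun p : (ι → α) × α => Function.update p.1 j p.2)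
      = fun p => (p.1 i, p.2) := by
    ext p <;> simp [Function.update_of_ne hij]
  rw [h2, h1.map_eq]

end ProductMeasures

/-! ### Transfer of almost sure statements to the mixture space. -/

section Mixture

variable {Ω Ω' : Type*} [mΩ : MeasurableSpace Ω] [mΩ' : MeasurableSpace Ω'] {π : Measure Ω}
  [IsProbabilityMeasure π] {π' : Measure Ω'} [IsProbabilityMeasure π'] {N : ℕ}
  {πs : Fin N → Measure Ω}

omit [IsProbabilityMeasure π] in
theorem IsIndependentMixture.isProbabilityMeasure_prod (h : IsIndependentMixture π πs) (i : Fin N) :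
    IsProbabilityMeasure ((πs i).prod π') :=
  have := h.isProb i
  inferInstance

omit [IsProbabilityMeasure π] in
theorem IsIndependentMixture.isProbabilityMeasure_mixture (h : IsIndependentMixture π πs) :
    IsProbabilityMeasure (mixtureMeasure πs π') :=
  have := h.isProbabilityMeasure_prod (π' := π')
  inferInstanceAs (IsProbabilityMeasure (Measure.pi fun i => (πs i).prod π'))

omit [IsProbabilityMeasure π] in
theorem IsIndependentMixture.quasiMeasurePreserving_eval (h : IsIndependentMixture π πs)
    (i : Fin N) :
    Measure.QuasiMeasurePreserving (fun a : Fin N → Ω × Ω' => a i) (mixtureMeasure πs π')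
      (π.prod π') := by
  have := h.isProbabilityMeasure_prod (π' := π')
  have := h.isProb
  exact ((measurePreserving_eval (fun i => (πs i).prod π') i).quasiMeasurePreserving).mono_right
    ((h.absCont i).prod Measure.AbsolutelyContinuous.rfl)

/-- It needs `i ≠ j`: the law of `(a i, a i)` lives on the diagonal, which may be null for the
product, and this is why diagonal weights cannot be sampled. -/
theorem IsIndependentMixture.quasiMeasurePreserving_eval_pair (h : IsIndependentMixture π πs)
    {i j : Fin N} (hij : i ≠ j) :
    Measure.QuasiMeasurePreserving (fun a : Fin N → Ω × Ω' => (a i, a j)) (mixtureMeasure πs π')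
      ((π.prod π').prod (π.prod π')) := by
  have := h.isProbabilityMeasure_prod (π' := π')
  have := h.isProb
  exact ((measurePreserving_eval_pair (fun i => (πs i).prod π') hij).quasiMeasurePreserving
    ).mono_right (((h.absCont i).prod Measure.AbsolutelyContinuous.rfl).prod
      ((h.absCont j).prod Measure.AbsolutelyContinuous.rfl))

theorem quasiMeasurePreserving_fst_pair :
    Measure.QuasiMeasurePreserving (fun p : (Ω × Ω') × (Ω × Ω') => (p.1.1, p.2.1))
      ((π.prod π').prod (π.prod π')) (π.prod π) :=
  ((measurePreserving_fst (μ := π) (ν := π')).prod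
    (measurePreserving_fst (μ := π) (ν := π'))).quasiMeasurePreserving

omit [IsProbabilityMeasure π] in
theorem IsIndependentMixture.quasiMeasurePreserving_fst (h : IsIndependentMixture π πs)
    (i : Fin N) :
    Measure.QuasiMeasurePreserving (fun a : Fin N → Ω × Ω' => (a i).1) (mixtureMeasure πs π') π :=
  (Measure.quasiMeasurePreserving_fst (μ := π) (ν := π')).comp (h.quasiMeasurePreserving_eval i)

omit [IsProbabilityMeasure π] in
theorem IsIndependentMixture.quasiMeasurePreserving_snd (h : IsIndependentMixture π πs)
    (i : Fin N) :
    Measure.QuasiMeasurePreserving (fun a : Fin N → Ω × Ω' => (a i).2) (mixtureMeasure πs π') π' :=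
  (Measure.quasiMeasurePreserving_snd (μ := π) (ν := π')).comp (h.quasiMeasurePreserving_eval i)

/-- The σ-algebra of events on the mixture space that are known at time `t`. -/
abbrev mixtureSigma (Ω : Type*) [mΩ : MeasurableSpace Ω] (N : ℕ) (ℱ : Filtration ℝ mΩ') (t : ℝ) :
    MeasurableSpace (Fin N → Ω × Ω') :=
  @MeasurableSpace.pi (Fin N) (fun _ => Ω × Ω') (fun _ => mΩ.prod (ℱ t))

theorem mixtureSigma_mono (N : ℕ) (ℱ : Filtration ℝ mΩ') : Monotone (mixtureSigma Ω N ℱ) :=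
  fun _ _ hst => iSup_mono fun _ => MeasurableSpace.comap_mono
    (sup_le_sup le_rfl (MeasurableSpace.comap_mono (ℱ.mono hst)))

theorem mixtureSigma_le (N : ℕ) (ℱ : Filtration ℝ mΩ') (t : ℝ) :
    mixtureSigma Ω N ℱ t ≤ MeasurableSpace.pi :=
  iSup_mono fun _ => MeasurableSpace.comap_mono
    (sup_le_sup le_rfl (MeasurableSpace.comap_mono (ℱ.le t)))

theorem measurable_eval_mixtureSigma (ℱ : Filtration ℝ mΩ') (t : ℝ) (i : Fin N) :
    Measurable[mixtureSigma Ω N ℱ t, mΩ.prod (ℱ t)] fun a => a i :=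
  @measurable_pi_apply _ _ (fun _ => mΩ.prod (ℱ t)) i

theorem measurable_fst_mixtureSigma (ℱ : Filtration ℝ mΩ') (t : ℝ) (i : Fin N) :
    Measurable[mixtureSigma Ω N ℱ t, mΩ] fun a => (a i).1 :=
  (@measurable_fst _ _ mΩ (ℱ t)).comp (measurable_eval_mixtureSigma ℱ t i)

theorem measurable_snd_mixtureSigma (ℱ : Filtration ℝ mΩ') (t : ℝ) (i : Fin N) :
    Measurable[mixtureSigma Ω N ℱ t, ℱ t] fun a => (a i).2 :=
  (@measurable_snd _ _ mΩ (ℱ t)).comp (measurable_eval_mixtureSigma ℱ t i)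

end Mixture

/-! ### Almost sure uniqueness and truncation. -/

section Agents

variable {d : ℕ} {k : StateSpaceKind} {Ω Ω' : Type*} [mΩ : MeasurableSpace Ω]
  [mΩ' : MeasurableSpace Ω'] {c : Coefficients d k} {M : ℝ} {π : Measure Ω}
  [IsProbabilityMeasure π] {π' : Measure Ω'} [IsProbabilityMeasure π'] {N : ℕ}
  {πs : Fin N → Measure Ω} {ℱ : Filtration ℝ mΩ'} {T : ℝ}
  {B : ℝ → Ω' → EuclideanSpace ℝ (Fin d)} {X₀ : Ω → StateSpace d k} {w₀ : Ω → Ω → ℝ}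

omit [IsProbabilityMeasure π'] in
theorem IsAgentSolution.ae_isAgentPath {X : Fin N → ℝ → (Fin N → Ω × Ω') → StateSpace d k}
    {w : Fin N → Fin N → ℝ → (Fin N → Ω × Ω') → ℝ} (h : IsAgentSolution c πs π' ℱ T B X₀ w₀ X w) :
    ∀ᵐ a ∂mixtureMeasure πs π',
      IsAgentPath c T (fun i t => B t (a i).2) (fun i t => X i t a) (fun i j t => w i j t a) := by
  have hwc : ∀ᵐ a ∂mixtureMeasure πs π', ∀ i j, i ≠ j →
      ContinuousOn (fun t => w i j t a) (Icc 0 T) :=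
    ae_all_iff.2 fun i => ae_all_iff.2 fun j => by
      by_cases hij : i = j
      · simp [hij]
      · simpa [hij] using h.w_continuous i j hij
  have hwe : ∀ᵐ a ∂mixtureMeasure πs π', ∀ i j, i ≠ j → ∀ t ∈ Icc 0 T, w i j t a = w i j 0 a
      + ∫ s in (0 : ℝ)..t, (c.α (X i s a) (X j s a) * w i j s a + c.β (X i s a) (X j s a)) :=
    ae_all_iff.2 fun i => ae_all_iff.2 fun j => by
      by_cases hij : i = j
      · simp [hij]
      · filter_upwards [h.w_eq i j hij] with a ha _ using ha
  filter_upwards [ae_all_iff.2 h.X_continuous, hwc, ae_all_iff.2 h.X_eq, hwe] with a h1 h2 h3 h4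
  exact ⟨h1, h2, h3, h4⟩

omit [IsProbabilityMeasure π'] in
theorem IsAgentSolution.ae_unique (hc : c.IsRegular M)
    {X Y : Fin N → ℝ → (Fin N → Ω × Ω') → StateSpace d k}
    {w v : Fin N → Fin N → ℝ → (Fin N → Ω × Ω') → ℝ}
    (hX : IsAgentSolution c πs π' ℱ T B X₀ w₀ X w) (hY : IsAgentSolution c πs π' ℱ T B X₀ w₀ Y v) :
    ∀ᵐ a ∂mixtureMeasure πs π', ∀ t ∈ Icc 0 T,
      (∀ i, X i t a = Y i t a) ∧ ∀ i j, i ≠ j → w i j t a = v i j t a := by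
  filter_upwards [hX.ae_isAgentPath, hY.ae_isAgentPath] with a h1 h2
  exact h1.unique hc h2 (fun i => (hX.X_init i a).trans (hY.X_init i a).symm)
    fun i j hij => (hX.w_init i j hij a).trans (hY.w_init i j hij a).symm

/-- Truncation of a real number to `[-R,R]`. -/
def truncate (R r : ℝ) : ℝ := max (-R) (min R r)

theorem continuous_truncate (R : ℝ) : Continuous (truncate R) := by
  unfold truncate; fun_prop

theorem abs_truncate_le {R : ℝ} (hR : 0 ≤ R) (r : ℝ) : |truncate R r| ≤ R := by
  unfold truncate
  rw [abs_le]
  exact ⟨le_max_left _ _, max_le (by linarith) (min_le_left _ _)⟩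

theorem truncate_of_abs_le {R r : ℝ} (h : |r| ≤ R) : truncate R r = r := by
  unfold truncate
  rw [abs_le] at h
  rw [min_eq_right h.2, max_eq_right h.1]

theorem abs_truncate_sub_le (R r s : ℝ) : |truncate R r - truncate R s| ≤ |r - s| := by
  unfold truncate
  refine (abs_max_sub_max_le_max _ _ _ _).trans ?_
  simpa using abs_min_sub_min_le_max R r R s

theorem abs_truncate_le_abs {R : ℝ} (hR : 0 ≤ R) (r : ℝ) : |truncate R r| ≤ |r| := by
  simpa [truncate, hR] using abs_truncate_sub_le R r 0

end Agents

/-- A finite family is the sum of its one-coordinate embeddings, which reduces joint measurability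
to finite sums. -/
theorem MeasureTheory.AEStronglyMeasurable.pi_subalgebra {A E ι : Type*} [Fintype ι] {m₀ : MeasurableSpace A}
    {P : Measure[m₀] A} {m : MeasurableSpace A} [NormedAddCommGroup E] {f : ι → A → E}
    (hf : ∀ i, AEStronglyMeasurable[m] (f i) P) :
    AEStronglyMeasurable[m] (fun a i => f i a) P := by
  classical
  have h : (fun a i => f i a) = fun a => ∑ i, Pi.single i (f i a) := by
    funext a
    exact (Finset.univ_sum_single _).symm
  rw [h]
  exact AEStronglyMeasurable.finset_sum_subalgebra _ fun i _ =>
    (continuous_single i).comp_aestronglyMeasurable (hf i)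

/-! ### The truncated vector field. -/

section Field

variable {d : ℕ} {k : StateSpaceKind} {c : Coefficients d k} {M R : ℝ} {N : ℕ}

/-- The agent states with initial values `x`, displacements `z.1` and noise values `b`. -/
def displacedState (c : Coefficients d k) (x : Fin N → StateSpace d k)
    (b : Fin N → EuclideanSpace ℝ (Fin d))
    (z : (Fin N → EuclideanSpace ℝ (Fin d)) × (Fin N → Fin N → ℝ)) : Fin N → StateSpace d k :=
  fun i => x i + StateSpace.proj d k (z.1 i + c.ν • b i)

/-- The truncated weights with initial values `w` and increments `z.2`. -/
def displacedWeight (R : ℝ) (w : Fin N → Fin N → ℝ)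
    (z : (Fin N → EuclideanSpace ℝ (Fin d)) × (Fin N → Fin N → ℝ)) : Fin N → Fin N → ℝ :=
  fun i j => truncate R (w i j + z.2 i j)

/-- The vector field of the `N`-agent system with truncated weights, written for the displacements
from the initial values and with the noise removed from the unknowns. -/
def agentField (c : Coefficients d k) (R : ℝ) (x : Fin N → StateSpace d k) (w : Fin N → Fin N → ℝ)
    (b : Fin N → EuclideanSpace ℝ (Fin d))
    (z : (Fin N → EuclideanSpace ℝ (Fin d)) × (Fin N → Fin N → ℝ)) :
    (Fin N → EuclideanSpace ℝ (Fin d)) × (Fin N → Fin N → ℝ) :=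
  (fun i => agentDrift c (displacedState c x b z) (displacedWeight R w z) i,
    fun i j => weightDrift c (displacedState c x b z i) (displacedState c x b z j)
      (displacedWeight R w z i j))

theorem continuous_agentField (hc : c.IsRegular M) (R : ℝ) :
    Continuous fun q : ((Fin N → StateSpace d k) × (Fin N → Fin N → ℝ) ×
      (Fin N → EuclideanSpace ℝ (Fin d))) ×
      ((Fin N → EuclideanSpace ℝ (Fin d)) × (Fin N → Fin N → ℝ)) =>
      agentField c R q.1.1 q.1.2.1 q.1.2.2 q.2 := by
  have h1 : Continuous fun q : ((Fin N → StateSpace d k) × (Fin N → Fin N → ℝ) ×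
      (Fin N → EuclideanSpace ℝ (Fin d))) ×
      ((Fin N → EuclideanSpace ℝ (Fin d)) × (Fin N → Fin N → ℝ)) =>
      displacedState c q.1.1 q.1.2.2 q.2 := by
    have := StateSpace.continuous_proj (d := d) (k := k)
    unfold displacedState
    fun_prop
  have h2 : Continuous fun q : ((Fin N → StateSpace d k) × (Fin N → Fin N → ℝ) ×
      (Fin N → EuclideanSpace ℝ (Fin d))) ×
      ((Fin N → EuclideanSpace ℝ (Fin d)) × (Fin N → Fin N → ℝ)) =>
      displacedWeight R q.1.2.1 q.2 := by
    have := continuous_truncate R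
    unfold displacedWeight
    fun_prop
  unfold agentField
  refine ((continuous_agentDrift hc).comp (h1.prodMk h2)).prodMk
    (continuous_pi fun i => continuous_pi fun j => (continuous_weightDrift hc).comp
      (((continuous_apply i).comp h1).prodMk (((continuous_apply j).comp h1).prodMk ?_)))
  exact (continuous_apply j).comp ((continuous_apply i).comp h2)

theorem norm_agentField_le (hc : c.IsRegular M) (hR : 0 ≤ R) (x : Fin N → StateSpace d k)
    (w : Fin N → Fin N → ℝ) (b : Fin N → EuclideanSpace ℝ (Fin d))
    (z : (Fin N → EuclideanSpace ℝ (Fin d)) × (Fin N → Fin N → ℝ)) :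
    ‖agentField c R x w b z‖ ≤ M + R * M := by
  have hM := hc.nonneg
  have h0 : 0 ≤ M + R * M := by positivity
  refine (Prod.norm_def _).le.trans (max_le ?_ ?_)
  · refine (pi_norm_le_iff_of_nonneg h0).2 fun i => ?_
    exact norm_agentDrift_le hc hR i fun j _ => abs_truncate_le hR _
  · refine (pi_norm_le_iff_of_nonneg h0).2 fun i => (pi_norm_le_iff_of_nonneg h0).2 fun j => ?_
    refine (abs_weightDrift_le hc _ _ _).trans ?_
    have := mul_le_mul_of_nonneg_left (abs_truncate_le hR (w i j + z.2 i j)) hM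
    simp only [displacedWeight]
    linarith

/-- The unknown lives in a normed space even for the torus, with the supremum norm over agents and
pairs; the factor `1/N` in the drift keeps the constant independent of `N`. -/
theorem lipschitzWith_agentField (hc : c.IsRegular M) (hR : 0 ≤ R) (x : Fin N → StateSpace d k)
    (w : Fin N → Fin N → ℝ) (b : Fin N → EuclideanSpace ℝ (Fin d)) :
    LipschitzWith (3 * M + 2 * R * M).toNNReal (agentField c R x w b) := by
  have hM := hc.nonneg
  have hK : 0 ≤ 3 * M + 2 * R * M := by positivity
  refine LipschitzWith.of_dist_le_mul fun z z' => ?_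
  rw [dist_eq_norm, dist_eq_norm, Real.coe_toNNReal _ hK]
  have hx : ∀ i, ‖displacedState c x b z i - displacedState c x b z' i‖ ≤ ‖z - z'‖ := by
    intro i
    unfold displacedState
    rw [add_sub_add_left_eq_sub, ← map_sub, add_sub_add_right_eq_sub]
    exact (StateSpace.norm_proj_le _).trans
      ((norm_le_pi_norm (z - z').1 i).trans (norm_fst_le _))
  have hw : ∀ i j, |displacedWeight R w z i j - displacedWeight R w z' i j| ≤ ‖z - z'‖ := by
    intro i j
    unfold displacedWeight
    refine (abs_truncate_sub_le _ _ _).trans ?_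
    rw [add_sub_add_left_eq_sub]
    exact ((norm_le_pi_norm ((z - z').2 i) j).trans (norm_le_pi_norm (z - z').2 i)).trans
      (norm_snd_le _)
  have hb : ∀ z : (Fin N → EuclideanSpace ℝ (Fin d)) × (Fin N → Fin N → ℝ), ∀ i j,
      |displacedWeight R w z i j| ≤ R := fun z i j => abs_truncate_le hR _
  have hr : 0 ≤ ‖z - z'‖ := norm_nonneg _
  have h0 : 0 ≤ (3 * M + 2 * R * M) * ‖z - z'‖ := by positivity
  have h1 : 0 ≤ M * ‖z - z'‖ := by positivity
  refine (Prod.norm_def _).le.trans (max_le ?_ ?_)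
  · refine (pi_norm_le_iff_of_nonneg h0).2 fun i => ?_
    refine (norm_agentDrift_sub_le_of_le hc hR hr i (fun j _ => hb z' i j) hx
      (fun j _ => hw i j)).trans ?_
    linarith
  · refine (pi_norm_le_iff_of_nonneg h0).2 fun i => (pi_norm_le_iff_of_nonneg h0).2 fun j => ?_
    refine (abs_weightDrift_sub_le hc (hb z' i j)).trans ?_
    have h2 := mul_le_mul_of_nonneg_left (hw i j) hM
    have h3 := mul_le_mul_of_nonneg_left (add_le_add (hx i) (hx j))
      (by positivity : 0 ≤ R * M + M)
    linarith

end Field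

/-! ### Existence for the agent system. -/

section Existence

variable {d : ℕ} {k : StateSpaceKind} {Ω Ω' : Type*} [mΩ : MeasurableSpace Ω]
  [mΩ' : MeasurableSpace Ω'] {c : Coefficients d k} {M : ℝ} {π : Measure Ω}
  [IsProbabilityMeasure π] {π' : Measure Ω'} [IsProbabilityMeasure π'] {N : ℕ}
  {πs : Fin N → Measure Ω} {ℱ : Filtration ℝ mΩ'} {T : ℝ}
  {B : ℝ → Ω' → EuclideanSpace ℝ (Fin d)} {X₀ : Ω → StateSpace d k} {w₀ : Ω → Ω → ℝ}

-- Solve the truncated equation for displacements without noise, restore the initial data and the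
-- noise, and check that almost surely the truncation is inactive.
set_option maxHeartbeats 1000000 in
theorem exists_isAgentSolution (hc : c.IsRegular M) (hi : IsInitialTriplet π X₀ w₀ M)
    (hT : 0 ≤ T) (hB : IsBrownianMotionOn π' ℱ T B) (hπ : IsIndependentMixture π πs) :
    ∃ (X : Fin N → ℝ → (Fin N → Ω × Ω') → StateSpace d k)
      (w : Fin N → Fin N → ℝ → (Fin N → Ω × Ω') → ℝ),
      IsAgentSolution c πs π' ℱ T B X₀ w₀ X w := by
  classical
  have hM := hc.nonneg
  set R := weightBound M T with hRdef
  have hR : 0 ≤ R := weightBound_nonneg hM hT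
  -- The modified noise is continuous and vanishes at time 0 for every sample, so the initial
  -- conditions hold for every realization and not merely almost surely.
  obtain ⟨b, hbc, -, hbB, hb0⟩ := exists_continuous_modification (P := π') (f := B) hT
    (fun t ht => ((hB.adapted t ht).mono (ℱ.le t)).aestronglyMeasurable) hB.continuous hB.zero
  have hbz : ∀ ω, b 0 ω = 0 := by
    intro ω
    rcases hb0 ω with h | ⟨h1, h2⟩
    · exact h 0
    · rw [h2, projIcc_left, h1]
  have hbm : ∀ t ∈ Icc 0 T, AEStronglyMeasurable[ℱ t] (b t) π' := fun t ht =>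
    ⟨B t, hB.adapted t ht, by filter_upwards [hbB] with ω h using h t ht⟩
  let x : (Fin N → Ω × Ω') → Fin N → StateSpace d k := fun a i => X₀ (a i).1
  -- The diagonal is replaced by 0 because almost everywhere measurability of `w₀` gives no control
  -- there.
  let u : (Fin N → Ω × Ω') → Fin N → Fin N → ℝ := fun a i j =>
    if i = j then 0 else w₀ (a i).1 (a j).1
  let β : (Fin N → Ω × Ω') → ℝ → Fin N → EuclideanSpace ℝ (Fin d) := fun a t i => b t (a i).2
  have hxm : ∀ t, ∀ i, AEStronglyMeasurable[mixtureSigma Ω N ℱ t] (fun a => x a i)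
      (mixtureMeasure πs π') := fun t i =>
    hi.X_memLp.aestronglyMeasurable.comp_quasiMeasurePreserving_subalgebra
      (measurable_fst_mixtureSigma ℱ t i) (hπ.quasiMeasurePreserving_fst i)
  have hum : ∀ t, ∀ i j, AEStronglyMeasurable[mixtureSigma Ω N ℱ t] (fun a => u a i j)
      (mixtureMeasure πs π') := by
    intro t i j
    by_cases hij : i = j
    · simpa [u, hij] using aestronglyMeasurable_const
    · simp only [u, if_neg hij]
      exact hi.w_meas.comp_quasiMeasurePreserving_subalgebra
        ((measurable_fst_mixtureSigma ℱ t i).prodMk (measurable_fst_mixtureSigma ℱ t j))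
        (quasiMeasurePreserving_fst_pair.comp (hπ.quasiMeasurePreserving_eval_pair hij))
  have hβm : ∀ t ∈ Icc 0 T, ∀ i, AEStronglyMeasurable[mixtureSigma Ω N ℱ t] (fun a => β a t i)
      (mixtureMeasure πs π') := fun t ht i =>
    (hbm t ht).comp_quasiMeasurePreserving_subalgebra
      (measurable_snd_mixtureSigma ℱ t i) (hπ.quasiMeasurePreserving_snd i)
  have hβc : ∀ a, Continuous (β a) := fun a => continuous_pi fun i => hbc (a i).2
  obtain ⟨z, hzm, hzc, hz⟩ := exists_adapted_ode_solution (P := mixtureMeasure πs π')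
    (mixtureSigma_mono (Ω := Ω) N ℱ) (F := fun a t => agentField c R (x a) (u a) (β a t)) hT
    (L := (M + R * M).toNNReal) (K := (3 * M + 2 * R * M).toNNReal)
    (fun a => (continuous_agentField hc R).comp
      (((continuous_const (y := x a)).prodMk ((continuous_const (y := u a)).prodMk
        ((hβc a).comp continuous_fst))).prodMk continuous_snd))
    (fun a t => lipschitzWith_agentField hc hR _ _ _)
    (fun a t q => by
      rw [Real.coe_toNNReal _ (by positivity)]; exact norm_agentField_le hc hR _ _ _ _)
    (fun t ht q hq => (continuous_agentField hc R).comp_aestronglyMeasurable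
      (((AEStronglyMeasurable.pi_subalgebra (hxm t)).prodMk
        ((AEStronglyMeasurable.pi_subalgebra fun i => AEStronglyMeasurable.pi_subalgebra
          (hum t i)).prodMk (AEStronglyMeasurable.pi_subalgebra (hβm t ht)))).prodMk hq))
  have hz0 : ∀ a, z 0 a = 0 := fun a => by simpa using hz a 0 ⟨le_rfl, hT⟩
  let X : Fin N → ℝ → (Fin N → Ω × Ω') → StateSpace d k := fun i t a =>
    x a i + StateSpace.proj d k ((z t a).1 i + c.ν • b t (a i).2)
  let w : Fin N → Fin N → ℝ → (Fin N → Ω × Ω') → ℝ := fun i j t a => u a i j + (z t a).2 i j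
  have hX0 : ∀ i a, X i 0 a = X₀ (a i).1 := fun i a => by simp [X, x, hz0, hbz]
  have hw0 : ∀ i j, i ≠ j → ∀ a, w i j 0 a = w₀ (a i).1 (a j).1 := fun i j hij a => by
    simp [w, u, hz0, hij]
  have hXc : ∀ i a, Continuous fun t => X i t a := fun i a => by
    have := StateSpace.continuous_proj (d := d) (k := k)
    have h2 := hzc a
    have h3 := hbc (a i).2
    simp only [X]
    fun_prop
  have hwc : ∀ i j a, Continuous fun t => w i j t a := fun i j a => by
    have h2 := hzc a
    simp only [w]
    fun_prop
  have hFc : ∀ a, Continuous fun s => agentField c R (x a) (u a) (β a s) (z s a) := fun a =>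
    (continuous_agentField hc R).comp
      (((continuous_const (y := x a)).prodMk ((continuous_const (y := u a)).prodMk
        (hβc a))).prodMk (hzc a))
  -- Coordinate projections are continuous linear maps, so they commute with the time integral.
  have hz1 : ∀ a, ∀ t ∈ Icc 0 T, ∀ i, (z t a).1 i = ∫ s in (0 : ℝ)..t,
      agentDrift c (fun j => X j s a) (fun j l => truncate R (w j l s a)) i := by
    intro a t ht i
    have h1 := ((ContinuousLinearMap.proj (R := ℝ)
      (φ := fun _ : Fin N => EuclideanSpace ℝ (Fin d)) i).comp
      (ContinuousLinearMap.fst ℝ (Fin N → EuclideanSpace ℝ (Fin d))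
        (Fin N → Fin N → ℝ))).intervalIntegral_comp_comm ((hFc a).intervalIntegrable (μ := volume) 0 t)
    rw [← hz a t ht] at h1
    exact h1.symm
  have hz2 : ∀ a, ∀ t ∈ Icc 0 T, ∀ i j, (z t a).2 i j = ∫ s in (0 : ℝ)..t,
      weightDrift c (X i s a) (X j s a) (truncate R (w i j s a)) := by
    intro a t ht i j
    have h1 := ((ContinuousLinearMap.proj (R := ℝ) (φ := fun _ : Fin N => ℝ) j).comp
      ((ContinuousLinearMap.proj (R := ℝ) (φ := fun _ : Fin N => Fin N → ℝ) i).comp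
      (ContinuousLinearMap.snd ℝ (Fin N → EuclideanSpace ℝ (Fin d))
        (Fin N → Fin N → ℝ)))).intervalIntegral_comp_comm ((hFc a).intervalIntegrable (μ := volume) 0 t)
    rw [← hz a t ht] at h1
    exact h1.symm
  -- Truncation does not increase absolute values, so the solution of the truncated equation obeys
  -- the same affine growth bound and stays below the truncation level `R`.
  have hbound : ∀ᵐ a ∂mixtureMeasure πs π', ∀ i j, i ≠ j → ∀ t ∈ Icc 0 T,
      truncate R (w i j t a) = w i j t a := by
    refine ae_all_iff.2 fun i => ae_all_iff.2 fun j => ?_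
    by_cases hij : i = j
    · simp [hij]
    · filter_upwards [(quasiMeasurePreserving_fst_pair.comp
        (hπ.quasiMeasurePreserving_eval_pair hij)).ae hi.w_bound] with a ha _ t ht
      refine truncate_of_abs_le (abs_le_weightBound (w₀ := u a i j) hM (hwc i j a).continuousOn
        (by simpa [u, hij] using ha) (fun t ht => by simp only [w]; rw [hz2 a t ht i j])
        (fun s _ => (abs_weightDrift_le hc _ _ _).trans ?_) ht)
      have := mul_le_mul_of_nonneg_left (abs_truncate_le_abs hR (w i j s a)) hM
      linarith
  have hnoise : ∀ᵐ a ∂mixtureMeasure πs π', ∀ i, ∀ t ∈ Icc 0 T, b t (a i).2 = B t (a i).2 :=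
    ae_all_iff.2 fun i => (hπ.quasiMeasurePreserving_snd i).ae hbB
  refine ⟨X, w,
    { X_adapted := fun i t ht => ?_
      w_adapted := fun i j _ t ht => ?_
      X_continuous := fun i => Filter.Eventually.of_forall fun a => (hXc i a).continuousOn
      w_continuous := fun i j _ => Filter.Eventually.of_forall fun a => (hwc i j a).continuousOn
      X_init := hX0
      w_init := hw0
      X_eq := fun i => ?_
      w_eq := fun i j hij => ?_ }⟩
  · have h1 : AEStronglyMeasurable[mixtureSigma Ω N ℱ t] (fun a => (z t a).1 i)
        (mixtureMeasure πs π') :=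
      ((continuous_apply i).comp continuous_fst).comp_aestronglyMeasurable (hzm t ht)
    exact (hxm t i).add (StateSpace.continuous_proj.comp_aestronglyMeasurable
      (h1.add ((hβm t ht i).const_smul c.ν)))
  · have h1 : AEStronglyMeasurable[mixtureSigma Ω N ℱ t] (fun a => (z t a).2 i j)
        (mixtureMeasure πs π') :=
      (by fun_prop : Continuous fun q : (Fin N → EuclideanSpace ℝ (Fin d)) × (Fin N → Fin N → ℝ) =>
        q.2 i j).comp_aestronglyMeasurable (hzm t ht)
    exact (hum t i j).add h1
  · filter_upwards [hbound, hnoise] with a ha hn t ht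
    have hint : ∫ s in (0 : ℝ)..t,
          agentDrift c (fun j => X j s a) (fun j l => truncate R (w j l s a)) i
        = ∫ s in (0 : ℝ)..t, (c.μ (X i s a) + (N : ℝ)⁻¹ • ∑ j ∈ Finset.univ.erase i,
          w i j s a • c.σ (X i s a) (X j s a)) := by
      refine intervalIntegral.integral_congr fun s hs => ?_
      rw [uIcc_of_le ht.1] at hs
      simp only [agentDrift]
      congr 2
      refine Finset.sum_congr rfl fun j hj => ?_
      rw [ha i j (Finset.ne_of_mem_erase hj).symm s ⟨hs.1, hs.2.trans ht.2⟩]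
    rw [hX0, ← hn i t ht, ← hint, ← hz1 a t ht i]
  · filter_upwards [hbound] with a ha t ht
    have hint : ∫ s in (0 : ℝ)..t, weightDrift c (X i s a) (X j s a) (truncate R (w i j s a))
        = ∫ s in (0 : ℝ)..t, (c.α (X i s a) (X j s a) * w i j s a + c.β (X i s a) (X j s a)) := by
      refine intervalIntegral.integral_congr fun s hs => ?_
      rw [uIcc_of_le ht.1] at hs
      simp only [weightDrift]
      rw [ha i j hij s ⟨hs.1, hs.2.trans ht.2⟩]
    rw [hw0 i j hij, ← hint, ← hz2 a t ht i j]
    simp only [w, u, if_neg hij]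

end Existence

/-! ### Expectation and time integration. -/

section Fubini

/-- Exchange of expectation and time integral for a bounded process with continuous paths. -/
theorem integral_le_intervalIntegral_of_forall_integral_le {A : Type*} [MeasurableSpace A]
    {Q : Measure A} [IsProbabilityMeasure Q] {f : ℝ → A → ℝ} {h : A → ℝ} {φ : ℝ → ℝ} {K t : ℝ}
    (ht : 0 ≤ t) (hfc : ∀ a, Continuous fun s => f s a) (hfm : ∀ s, StronglyMeasurable (f s))
    (hfK : ∀ s a, |f s a| ≤ K) (hh : Integrable h Q) (hφ : Continuous φ)
    (hhf : ∀ᵐ a ∂Q, h a ≤ ∫ s in (0 : ℝ)..t, f s a)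
    (hfφ : ∀ s ∈ Icc 0 t, ∫ a, f s a ∂Q ≤ φ s) :
    ∫ a, h a ∂Q ≤ ∫ s in (0 : ℝ)..t, φ s := by
  -- Continuity in time together with measurability at each time gives joint measurability.
  have hm : StronglyMeasurable (Function.uncurry f) :=
    stronglyMeasurable_uncurry_of_continuous_of_stronglyMeasurable hfc hfm
  have hint : Integrable (Function.uncurry f) ((volume.restrict (uIoc 0 t)).prod Q) := by
    have : IsFiniteMeasure (volume.restrict (uIoc 0 t)) := by
      rw [uIoc_of_le ht]; infer_instance
    exact Integrable.of_bound hm.aestronglyMeasurable K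
      (Filter.Eventually.of_forall fun p => hfK p.1 p.2)
  have h1 : Integrable (fun a => ∫ s in (0 : ℝ)..t, f s a) Q := by
    have := hint.integral_prod_right
    simpa only [intervalIntegral.integral_of_le ht, uIoc_of_le ht, Function.uncurry_apply_pair] using this
  have h2 : Continuous fun s => ∫ a, f s a ∂Q :=
    continuous_of_dominated (bound := fun _ => K) (fun s => (hfm s).aestronglyMeasurable)
      (fun s => Filter.Eventually.of_forall fun a => hfK s a) (integrable_const K)
      (Filter.Eventually.of_forall hfc)
  calc ∫ a, h a ∂Q ≤ ∫ a, (∫ s in (0 : ℝ)..t, f s a) ∂Q := integral_mono_ae hh h1 hhf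
    _ = ∫ s in (0 : ℝ)..t, ∫ a, f s a ∂Q := (intervalIntegral_integral_swap hint).symm
    _ ≤ ∫ s in (0 : ℝ)..t, φ s := intervalIntegral.integral_mono_on ht
      (h2.intervalIntegrable _ _) (hφ.intervalIntegrable _ _) hfφ

end Fubini

/-! ### Orthogonality of fluctuations. -/

section LawOfLargeNumbers

variable {ι α E : Type*} [Fintype ι] [DecidableEq ι] [MeasurableSpace α] [NormedAddCommGroup E]
  [InnerProductSpace ℝ E] [CompleteSpace E] {P : ι → Measure α} [∀ i, IsProbabilityMeasure (P i)]
  {H : α × α → E} {K : ℝ}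

/-- The fluctuation of `H (a i, a j)` around its conditional mean given `a i`. -/
def fluctuation (P : ι → Measure α) (H : α × α → E) (i j : ι) (a : ι → α) : E :=
  H (a i, a j) - ∫ b, H (a i, b) ∂P j

omit [DecidableEq ι] [Fintype ι] [CompleteSpace E] in
theorem stronglyMeasurable_fluctuation (hH : StronglyMeasurable H) (i j : ι) :
    StronglyMeasurable (fluctuation P H i j) := by
  have h1 : StronglyMeasurable fun a : α => ∫ b, H (a, b) ∂P j :=
    StronglyMeasurable.integral_prod_right (f := fun a b => H (a, b)) hH
  exact (hH.comp_measurable (by fun_prop)).sub (h1.comp_measurable (measurable_pi_apply i))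

omit [DecidableEq ι] [Fintype ι] [CompleteSpace E] in
theorem norm_fluctuation_le (hK : ∀ p, ‖H p‖ ≤ K) (i j : ι) (a : ι → α) :
    ‖fluctuation P H i j a‖ ≤ 2 * K := by
  have h1 : ‖∫ b, H (a i, b) ∂P j‖ ≤ K := by
    simpa using norm_integral_le_of_norm_le_const (μ := P j) (f := fun b => H (a i, b))
      (Filter.Eventually.of_forall fun b => hK (a i, b))
  exact (norm_sub_le _ _).trans (by linarith [hK (a i, a j)])

/-- Integrate coordinate `j` first. The factor with index `l` does not depend on it, and the other
has mean zero in it once `a i` is fixed. -/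
theorem integral_inner_fluctuation_eq_zero (hH : StronglyMeasurable H) (hK : ∀ p, ‖H p‖ ≤ K)
    {i j l : ι} (hij : i ≠ j) (hlj : l ≠ j) :
    ∫ a, inner ℝ (fluctuation P H i j a) (fluctuation P H i l a) ∂Measure.pi P = 0 := by
  have hm : StronglyMeasurable fun a =>
      inner ℝ (fluctuation P H i j a) (fluctuation P H i l a) :=
    (stronglyMeasurable_fluctuation hH i j).inner (stronglyMeasurable_fluctuation hH i l)
  have hu := measurePreserving_update_pi P j
  have hb : ∀ a : ι → α,
      ‖(inner ℝ (fluctuation P H i j a) (fluctuation P H i l a) : ℝ)‖ ≤ 2 * K * (2 * K) :=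
    fun a => (norm_inner_le_norm _ _).trans (mul_le_mul (norm_fluctuation_le hK i j a)
      (norm_fluctuation_le hK i l a) (norm_nonneg _)
      ((norm_nonneg _).trans (norm_fluctuation_le (P := P) hK i j a)))
  rw [← hu.map_eq, integral_map hu.measurable.aemeasurable hm.aestronglyMeasurable,
    integral_prod (fun p : (ι → α) × α => inner ℝ (fluctuation P H i j (Function.update p.1 j p.2))
      (fluctuation P H i l (Function.update p.1 j p.2))) (Integrable.of_bound
      (hm.comp_measurable hu.measurable).aestronglyMeasurable _
      (Filter.Eventually.of_forall fun p => hb _))]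
  refine integral_eq_zero_of_ae (Filter.Eventually.of_forall fun a => ?_)
  have h1 : ∀ b, fluctuation P H i l (Function.update a j b) = fluctuation P H i l a := by
    intro b
    simp only [fluctuation, Function.update_of_ne hij, Function.update_of_ne hlj]
  have h2 : ∀ b, fluctuation P H i j (Function.update a j b)
      = H (a i, b) - ∫ b, H (a i, b) ∂P j := by
    intro b
    simp only [fluctuation, Function.update_of_ne hij, Function.update_self]
  have h3 : Integrable (fun b => H (a i, b)) (P j) :=
    Integrable.of_bound (hH.comp_measurable (by fun_prop)).aestronglyMeasurable K
      (Filter.Eventually.of_forall fun b => hK _)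
  simp only [h1, h2, Pi.zero_apply]
  simp_rw [real_inner_comm (fluctuation P H i l a)]
  rw [integral_inner (f := fun b => H (a i, b) - ∫ b, H (a i, b) ∂P j)
    (h3.sub (integrable_const _)), integral_sub h3 (integrable_const _)]
  simp

/-- The averaged fluctuations are of order `N^{-1/2}` in mean. -/
theorem integral_norm_average_fluctuation_le (hH : StronglyMeasurable H) (hK : ∀ p, ‖H p‖ ≤ K)
    (i : ι) : ∫ a, ‖(Fintype.card ι : ℝ)⁻¹ • ∑ j ∈ Finset.univ.erase i, fluctuation P H i j a‖
      ∂Measure.pi P ≤ (4 * K ^ 2 + 1) / 2 * (√(Fintype.card ι))⁻¹ := by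
  set n : ℝ := (Fintype.card ι : ℝ) with hn
  have hn0 : 0 < n := by
    have : Nonempty ι := ⟨i⟩
    exact Nat.cast_pos.2 Fintype.card_pos
  have hs0 : 0 < √n := Real.sqrt_pos.2 hn0
  have hss : √n * √n = n := Real.mul_self_sqrt hn0.le
  have hm : ∀ j l, StronglyMeasurable fun a =>
      inner ℝ (fluctuation P H i j a) (fluctuation P H i l a) := fun j l =>
    (stronglyMeasurable_fluctuation hH i j).inner (stronglyMeasurable_fluctuation hH i l)
  have hb : ∀ j l (a : ι → α), ‖(inner ℝ (fluctuation P H i j a) (fluctuation P H i l a) : ℝ)‖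
      ≤ 2 * K * (2 * K) :=
    fun j l a => (norm_inner_le_norm _ _).trans (mul_le_mul (norm_fluctuation_le hK i j a)
      (norm_fluctuation_le hK i l a) (norm_nonneg _)
      ((norm_nonneg _).trans (norm_fluctuation_le (P := P) hK i j a)))
  have hint : ∀ j l, Integrable (fun a =>
      inner ℝ (fluctuation P H i j a) (fluctuation P H i l a)) (Measure.pi P) := fun j l =>
    Integrable.of_bound (hm j l).aestronglyMeasurable _ (Filter.Eventually.of_forall (hb j l))
  have hsq : ∀ a, ‖∑ j ∈ Finset.univ.erase i, fluctuation P H i j a‖ ^ 2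
      = ∑ j ∈ Finset.univ.erase i, ∑ l ∈ Finset.univ.erase i,
        inner ℝ (fluctuation P H i j a) (fluctuation P H i l a) := by
    intro a
    rw [← real_inner_self_eq_norm_sq, sum_inner]
    simp_rw [inner_sum]
  -- Only the diagonal of the double sum survives, with at most `n` terms, each at most `(2 * K) ^
  -- 2`.
  have hsecond : ∫ a, ‖∑ j ∈ Finset.univ.erase i, fluctuation P H i j a‖ ^ 2 ∂Measure.pi P
      ≤ n * (4 * K ^ 2) := by
    simp_rw [hsq]
    rw [integral_finsetSum _ fun j _ => integrable_finsetSum _ fun l _ => hint j l]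
    have h1 : ∀ j ∈ Finset.univ.erase i, ∫ a, ∑ l ∈ Finset.univ.erase i,
        inner ℝ (fluctuation P H i j a) (fluctuation P H i l a) ∂Measure.pi P ≤ 4 * K ^ 2 := by
      intro j hj
      rw [integral_finsetSum _ fun l _ => hint j l, Finset.sum_eq_single_of_mem j hj
        fun l _ hl => integral_inner_fluctuation_eq_zero hH hK (Finset.ne_of_mem_erase hj).symm hl]
      refine (le_abs_self _).trans ?_
      have := norm_integral_le_of_norm_le_const (μ := Measure.pi P)
        (Filter.Eventually.of_forall (hb j j))
      simp only [probReal_univ, mul_one] at this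
      exact this.trans (by linarith)
    refine (Finset.sum_le_card_nsmul _ _ _ h1).trans ?_
    rw [nsmul_eq_mul]
    refine mul_le_mul_of_nonneg_right ?_ (by positivity)
    exact Nat.cast_le.2 (Finset.card_le_univ _)
  have hSm : StronglyMeasurable fun a => ∑ j ∈ Finset.univ.erase i, fluctuation P H i j a :=
    Finset.stronglyMeasurable_fun_sum _ fun j _ => stronglyMeasurable_fluctuation hH i j
  have hSint : Integrable (fun a => ‖∑ j ∈ Finset.univ.erase i, fluctuation P H i j a‖ ^ 2)
      (Measure.pi P) := by
    simp_rw [hsq]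
    exact integrable_finsetSum _ fun j _ => integrable_finsetSum _ fun l _ => hint j l
  -- The arithmetic–geometric mean inequality, scaled by `√n`, passes from the second moment to the
  -- first pointwise, in place of Cauchy–Schwarz.
  have hpt : ∀ a, ‖n⁻¹ • ∑ j ∈ Finset.univ.erase i, fluctuation P H i j a‖
      ≤ (√n)⁻¹ / 2 * (n⁻¹ * ‖∑ j ∈ Finset.univ.erase i, fluctuation P H i j a‖ ^ 2 + 1) := by
    intro a
    rw [norm_smul, Real.norm_of_nonneg (by positivity)]
    set x := ‖∑ j ∈ Finset.univ.erase i, fluctuation P H i j a‖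
    have h2 : n⁻¹ = (√n)⁻¹ * (√n)⁻¹ := by rw [← mul_inv, hss]
    rw [h2]
    have h3 : 0 < (√n)⁻¹ := by positivity
    nlinarith [sq_nonneg ((√n)⁻¹ * x - 1)]
  refine (integral_mono_of_nonneg (Filter.Eventually.of_forall fun a => norm_nonneg _)
    (((hSint.const_mul _).add (integrable_const _)).const_mul _)
    (Filter.Eventually.of_forall hpt)).trans ?_
  simp only [Pi.add_apply]
  rw [integral_const_mul, integral_add (hSint.const_mul _) (integrable_const _),
    integral_const_mul, integral_const, probReal_univ, one_smul]
  have h4 : n⁻¹ * ∫ a, ‖∑ j ∈ Finset.univ.erase i, fluctuation P H i j a‖ ^ 2 ∂Measure.pi P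
      ≤ 4 * K ^ 2 := by
    rw [inv_mul_le_iff₀ hn0]; exact hsecond
  have h5 : 0 < (√n)⁻¹ := by positivity
  nlinarith

end LawOfLargeNumbers

/-! ### The law of large numbers for independent mixtures. -/

section MixtureAverage

variable {Ω Ω' E : Type*} [mΩ : MeasurableSpace Ω] [mΩ' : MeasurableSpace Ω'] {π : Measure Ω}
  [IsProbabilityMeasure π] {π' : Measure Ω'} [IsProbabilityMeasure π'] {N : ℕ}
  {πs : Fin N → Measure Ω} [NormedAddCommGroup E] [InnerProductSpace ℝ E] [CompleteSpace E] {K : ℝ}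

omit [CompleteSpace E] in
theorem IsIndependentMixture.integral_eq_average (h : IsIndependentMixture π πs) {f : Ω × Ω' → E}
    (hf : StronglyMeasurable f) (hK : ∀ b, ‖f b‖ ≤ K) :
    ∫ b, f b ∂π.prod π' = (N : ℝ)⁻¹ • ∑ j, ∫ b, f b ∂(πs j).prod π' := by
  have := h.isProb
  have hint : ∀ ρ : Measure Ω, IsProbabilityMeasure ρ → Integrable f (ρ.prod π') := fun ρ _ =>
    Integrable.of_bound hf.aestronglyMeasurable K (Filter.Eventually.of_forall hK)
  have hg : StronglyMeasurable fun ξ => ∫ η, f (ξ, η) ∂π' :=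
    StronglyMeasurable.integral_prod_right (f := fun a b => f (a, b)) hf
  have hgK : ∀ ξ, ‖∫ η, f (ξ, η) ∂π'‖ ≤ K := fun ξ => by
    simpa using norm_integral_le_of_norm_le_const (μ := π') (f := fun η => f (ξ, η))
      (Filter.Eventually.of_forall fun b => hK (ξ, b))
  rw [integral_prod _ (hint π inferInstance)]
  calc ∫ ξ, ∫ η, f (ξ, η) ∂π' ∂π
      = ∫ ξ, ∫ η, f (ξ, η) ∂π' ∂((N : ℝ≥0∞)⁻¹ • ∑ j, πs j) := by rw [h.average]
    _ = (N : ℝ)⁻¹ • ∑ j, ∫ ξ, ∫ η, f (ξ, η) ∂π' ∂πs j := by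
      rw [integral_smul_measure, integral_finsetSum_measure fun j _ =>
        Integrable.of_bound hg.aestronglyMeasurable K (Filter.Eventually.of_forall hgK)]
      simp
    _ = _ := by
      congr 1
      exact Finset.sum_congr rfl fun j _ => (integral_prod _ (hint _ (h.isProb j))).symm

/-- The empirical interaction felt by the `i`-th independently sampled agent is `N^{-1/2}`-close in
mean to the interaction with the average law. -/
theorem IsIndependentMixture.integral_norm_empirical_sub_le (h : IsIndependentMixture π πs)
    {H : (Ω × Ω') × (Ω × Ω') → E} (hH : StronglyMeasurable H) (hK : ∀ p, ‖H p‖ ≤ K) (i : Fin N) :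
    ∫ a, ‖(N : ℝ)⁻¹ • ∑ j ∈ Finset.univ.erase i, H (a i, a j) - ∫ b, H (a i, b) ∂π.prod π'‖
      ∂mixtureMeasure πs π' ≤ ((4 * K ^ 2 + 1) / 2 + K) * (√N)⁻¹ := by
  have hprob := h.isProbabilityMeasure_prod (π' := π')
  have hQ := h.isProbabilityMeasure_mixture (π' := π')
  have hN : (1 : ℝ) ≤ N := by exact_mod_cast i.pos
  have hs : 1 ≤ √(N : ℝ) := Real.one_le_sqrt.2 hN
  have hK0 : ∀ a : Fin N → Ω × Ω', 0 ≤ K := fun a => (norm_nonneg _).trans (hK (a i, a i))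
  have hdecomp : ∀ a : Fin N → Ω × Ω',
      ‖(N : ℝ)⁻¹ • ∑ j ∈ Finset.univ.erase i, H (a i, a j) - ∫ b, H (a i, b) ∂π.prod π'‖
      ≤ ‖(N : ℝ)⁻¹ • ∑ j ∈ Finset.univ.erase i,
          fluctuation (fun j => (πs j).prod π') H i j a‖ + K * (√N)⁻¹ := by
    intro a
    have h1 : ‖∫ b, H (a i, b) ∂(πs i).prod π'‖ ≤ K := by
      simpa using norm_integral_le_of_norm_le_const (μ := (πs i).prod π')
        (f := fun b => H (a i, b)) (Filter.Eventually.of_forall fun b => hK (a i, b))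
    rw [h.integral_eq_average (f := fun b => H (a i, b)) (hH.comp_measurable (by fun_prop))
      fun b => hK (a i, b),
      ← Finset.add_sum_erase Finset.univ _ (Finset.mem_univ i)]
    -- Besides the fluctuations there remains the self-interaction term, present in the mean but
    -- absent from the empirical sum; it costs `K / N`, at most `K / √N`.
    have h2 : (N : ℝ)⁻¹ • ∑ j ∈ Finset.univ.erase i, H (a i, a j)
        - (N : ℝ)⁻¹ • (∫ b, H (a i, b) ∂(πs i).prod π'
          + ∑ j ∈ Finset.univ.erase i, ∫ b, H (a i, b) ∂(πs j).prod π')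
        = (N : ℝ)⁻¹ • ∑ j ∈ Finset.univ.erase i, fluctuation (fun j => (πs j).prod π') H i j a
          - (N : ℝ)⁻¹ • ∫ b, H (a i, b) ∂(πs i).prod π' := by
      simp only [fluctuation, Finset.sum_sub_distrib]
      module
    rw [h2]
    refine (norm_sub_le _ _).trans (add_le_add le_rfl ?_)
    rw [norm_smul, Real.norm_of_nonneg (by positivity), mul_comm]
    refine mul_le_mul h1 ?_ (by positivity) (hK0 a)
    refine inv_anti₀ (by positivity) ?_
    nlinarith [Real.mul_self_sqrt (zero_le_one.trans hN)]
  have hm : StronglyMeasurable fun a => (N : ℝ)⁻¹ • ∑ j ∈ Finset.univ.erase i,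
      fluctuation (fun j => (πs j).prod π') H i j a :=
    (Finset.stronglyMeasurable_fun_sum _ fun j _ =>
      stronglyMeasurable_fluctuation hH i j).const_smul _
  have hint : Integrable (fun a => ‖(N : ℝ)⁻¹ • ∑ j ∈ Finset.univ.erase i,
      fluctuation (fun j => (πs j).prod π') H i j a‖) (mixtureMeasure πs π') := by
    refine (Integrable.of_bound hm.aestronglyMeasurable (2 * K)
      (Filter.Eventually.of_forall fun a => ?_)).norm
    exact (norm_inv_smul_sum_erase_le i _).trans (average_erase_le (by linarith [hK0 a]) i
      fun j _ => norm_fluctuation_le hK i j a)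
  refine (integral_mono_of_nonneg (Filter.Eventually.of_forall fun a => norm_nonneg _)
    (hint.add (integrable_const _)) (Filter.Eventually.of_forall hdecomp)).trans ?_
  simp only [Pi.add_apply]
  rw [integral_add hint (integrable_const _), integral_const, probReal_univ, one_smul, add_mul]
  refine add_le_add ?_ le_rfl
  have := integral_norm_average_fluctuation_le (P := fun j => (πs j).prod π') hH hK i
  simp only [Fintype.card_fin] at this
  exact this

end MixtureAverage

/-! ### Continuous versions with bounded weights. -/

section RegularVersions

variable {d : ℕ} {k : StateSpaceKind} {Ω Ω' : Type*} [mΩ : MeasurableSpace Ω]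
  [mΩ' : MeasurableSpace Ω'] {c : Coefficients d k} {M V : ℝ} {π : Measure Ω}
  [IsProbabilityMeasure π] {π' : Measure Ω'} [IsProbabilityMeasure π'] {N : ℕ}
  {πs : Fin N → Measure Ω} {ℱ : Filtration ℝ mΩ'} {T : ℝ}
  {B : ℝ → Ω' → EuclideanSpace ℝ (Fin d)} {X₀ : Ω → StateSpace d k} {w₀ : Ω → Ω → ℝ}

/-- A version of a solution of the `N`-agent system whose paths are all continuous and whose
weights are everywhere bounded by `V`. -/
structure IsRegularAgentVersion (c : Coefficients d k) (πs : Fin N → Measure Ω) (π' : Measure Ω')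
    (T : ℝ) (B : ℝ → Ω' → EuclideanSpace ℝ (Fin d)) (X₀ : Ω → StateSpace d k) (w₀ : Ω → Ω → ℝ)
    (V : ℝ) (x : Fin N → ℝ → (Fin N → Ω × Ω') → StateSpace d k)
    (w : Fin N → Fin N → ℝ → (Fin N → Ω × Ω') → ℝ) : Prop where
  x_continuous : ∀ i a, Continuous fun t => x i t a
  w_continuous : ∀ i j a, Continuous fun t => w i j t a
  x_measurable : ∀ i t, StronglyMeasurable (x i t)
  w_measurable : ∀ i j t, StronglyMeasurable (w i j t)
  w_bound : ∀ i j t a, |w i j t a| ≤ V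
  x_eq : ∀ i, ∀ᵐ a ∂mixtureMeasure πs π', ∀ t ∈ Icc 0 T, x i t a = X₀ (a i).1
    + StateSpace.proj d k ((∫ s in (0 : ℝ)..t,
      agentDrift c (fun j => x j s a) (fun j l => w j l s a) i) + c.ν • B t (a i).2)
  w_eq : ∀ i j, i ≠ j → ∀ᵐ a ∂mixtureMeasure πs π', ∀ t ∈ Icc 0 T, w i j t a
    = w₀ (a i).1 (a j).1 + ∫ s in (0 : ℝ)..t, weightDrift c (x i s a) (x j s a) (w i j s a)

/-- The pairwise interaction in the McKean–Vlasov system. -/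
def interaction (c : Coefficients d k) (x : ℝ → Ω × Ω' → StateSpace d k)
    (w : ℝ → (Ω × Ω') × (Ω × Ω') → ℝ) (s : ℝ) (p : (Ω × Ω') × (Ω × Ω')) :
    EuclideanSpace ℝ (Fin d) :=
  w s p • c.σ (x s p.1) (x s p.2)

/-- A version of a McKean–Vlasov solution whose paths are all continuous and whose weights are
everywhere bounded by `V`. -/
structure IsRegularMcKeanVlasovVersion (c : Coefficients d k) (π : Measure Ω) (π' : Measure Ω')
    (T : ℝ) (B : ℝ → Ω' → EuclideanSpace ℝ (Fin d)) (X₀ : Ω → StateSpace d k) (w₀ : Ω → Ω → ℝ)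
    (V : ℝ) (x : ℝ → Ω × Ω' → StateSpace d k) (w : ℝ → (Ω × Ω') × (Ω × Ω') → ℝ) : Prop where
  x_continuous : ∀ a, Continuous fun t => x t a
  w_continuous : ∀ p, Continuous fun t => w t p
  x_measurable : ∀ t, StronglyMeasurable (x t)
  w_measurable : ∀ t, StronglyMeasurable (w t)
  w_bound : ∀ t p, |w t p| ≤ V
  x_eq : ∀ᵐ a ∂π.prod π', ∀ t ∈ Icc 0 T, x t a = X₀ a.1
    + StateSpace.proj d k ((∫ s in (0 : ℝ)..t,
      (c.μ (x s a) + ∫ b, interaction c x w s (a, b) ∂π.prod π')) + c.ν • B t a.2)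
  w_eq : ∀ᵐ p ∂(π.prod π').prod (π.prod π'), ∀ t ∈ Icc 0 T, w t p
    = w₀ p.1.1 p.2.1 + ∫ s in (0 : ℝ)..t, weightDrift c (x s p.1) (x s p.2) (w s p)

theorem intervalIntegral_congr_of_forall_mem_Icc {E : Type*} [NormedAddCommGroup E]
    [NormedSpace ℝ E] {f g : ℝ → E} {t : ℝ} (ht : t ∈ Icc 0 T)
    (h : ∀ s ∈ Icc 0 T, f s = g s) : ∫ s in (0 : ℝ)..t, f s = ∫ s in (0 : ℝ)..t, g s := by
  refine intervalIntegral.integral_congr fun s hs => ?_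
  rw [uIcc_of_le ht.1] at hs
  exact h s ⟨hs.1, hs.2.trans ht.2⟩

theorem IsAgentSolution.exists_regularVersion (hc : c.IsRegular M)
    (hi : IsInitialTriplet π X₀ w₀ M) (hT : 0 ≤ T) (hπ : IsIndependentMixture π πs)
    {X : Fin N → ℝ → (Fin N → Ω × Ω') → StateSpace d k}
    {w : Fin N → Fin N → ℝ → (Fin N → Ω × Ω') → ℝ}
    (h : IsAgentSolution c πs π' ℱ T B X₀ w₀ X w) :
    ∃ (x : Fin N → ℝ → (Fin N → Ω × Ω') → StateSpace d k)
      (u : Fin N → Fin N → ℝ → (Fin N → Ω × Ω') → ℝ),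
      IsRegularAgentVersion c πs π' T B X₀ w₀ (weightBound M T) x u ∧
      (∀ i, ∀ᵐ a ∂mixtureMeasure πs π', ∀ t ∈ Icc 0 T, x i t a = X i t a) ∧
      ∀ i j, i ≠ j → ∀ᵐ a ∂mixtureMeasure πs π', ∀ t ∈ Icc 0 T, u i j t a = w i j t a := by
  have hM := hc.nonneg
  have hV := weightBound_nonneg hM hT
  have hwb : ∀ i j, i ≠ j → ∀ᵐ a ∂mixtureMeasure πs π', ∀ t ∈ Icc 0 T,
      |w i j t a| ≤ weightBound M T := by
    intro i j hij
    filter_upwards [h.w_continuous i j hij, h.w_eq i j hij,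
      (quasiMeasurePreserving_fst_pair.comp (hπ.quasiMeasurePreserving_eval_pair hij)).ae
        hi.w_bound] with a h1 h2 h3 t ht
    refine abs_le_weightBound hM h1 h3 (fun t ht => ?_)
      (fun s _ => abs_weightDrift_le hc (X i s a) (X j s a) _) ht
    rw [h2 t ht, h.w_init i j hij a]
    rfl
  choose x hxc hxm hx _ using fun i => exists_continuous_modification
    (P := mixtureMeasure πs π') hT
    (fun t ht => (h.X_adapted i t ht).mono (mixtureSigma_le N ℱ t)) (h.X_continuous i)
    (p := fun _ => True) (by simp)
  have hu : ∀ i j, ∃ u : ℝ → (Fin N → Ω × Ω') → ℝ, (∀ a, Continuous fun t => u t a) ∧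
      (∀ t, StronglyMeasurable (u t)) ∧ (∀ t a, |u t a| ≤ weightBound M T) ∧
      (i ≠ j → ∀ᵐ a ∂mixtureMeasure πs π', ∀ t ∈ Icc 0 T, u t a = w i j t a) := by
    intro i j
    by_cases hij : i = j
    -- Diagonal weights get the zero version, so regularity holds for all index pairs.
    · exact ⟨fun _ _ => 0, fun _ => continuous_const, fun _ => stronglyMeasurable_const,
        fun _ _ => by simpa using hV, fun hne => absurd hij hne⟩
    · obtain ⟨u, h1, h2, h3, h4⟩ := exists_continuous_modification (P := mixtureMeasure πs π') hT
        (fun t ht => (h.w_adapted i j hij t ht).mono (mixtureSigma_le N ℱ t))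
        (h.w_continuous i j hij) (hwb i j hij)
      refine ⟨u, h1, h2, fun t a => ?_, fun _ => h3⟩
      rcases h4 a with h0 | ⟨h5, h6⟩
      · rw [h0, abs_zero]; exact hV
      · rw [h6]; exact h5 _ (Subtype.prop _)
  choose u huc hum hub hu using hu
  refine ⟨x, u, ⟨hxc, huc, hxm, hum, hub, fun i => ?_, fun i j hij => ?_⟩, hx, hu⟩
  · have hall : ∀ᵐ a ∂mixtureMeasure πs π', ∀ j, i ≠ j → ∀ t ∈ Icc 0 T, u i j t a = w i j t a := by
      refine ae_all_iff.2 fun j => ?_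
      by_cases hij : i = j
      · simp [hij]
      · filter_upwards [hu i j hij] with a ha _ using ha
    filter_upwards [h.X_eq i, ae_all_iff.2 hx, hall] with a h1 h2 h3 t ht
    rw [h2 i t ht, h1 t ht, h.X_init]
    congr 3
    refine intervalIntegral_congr_of_forall_mem_Icc ht fun s hs => ?_
    simp only [agentDrift, h2 _ s hs]
    congr 2
    exact Finset.sum_congr rfl fun j hj => by rw [h3 j (Finset.ne_of_mem_erase hj).symm s hs]
  · filter_upwards [h.w_eq i j hij, hx i, hx j, hu i j hij] with a h1 h2 h3 h4 t ht
    rw [h4 t ht, h1 t ht, h.w_init i j hij]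
    congr 1
    refine intervalIntegral_congr_of_forall_mem_Icc ht fun s hs => ?_
    rw [h2 s hs, h3 s hs, h4 s hs, weightDrift]

/-- The given weights are only known to be essentially bounded at each time, with no common
constant; the a priori estimate supplies one that depends on `M` and `T` alone. -/
theorem IsMcKeanVlasovSolution.exists_regularVersion (hc : c.IsRegular M)
    (hi : IsInitialTriplet π X₀ w₀ M) (hT : 0 ≤ T)
    {X : ℝ → Ω × Ω' → StateSpace d k} {w : ℝ → Ω × Ω' → Ω × Ω' → ℝ}
    (h : IsMcKeanVlasovSolution c π π' ℱ T B X₀ w₀ X w) :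
    ∃ (x : ℝ → Ω × Ω' → StateSpace d k) (u : ℝ → (Ω × Ω') × (Ω × Ω') → ℝ),
      IsRegularMcKeanVlasovVersion c π π' T B X₀ w₀ (weightBound M T) x u ∧
      (∀ᵐ a ∂π.prod π', ∀ t ∈ Icc 0 T, x t a = X t a) ∧
      ∀ᵐ p ∂(π.prod π').prod (π.prod π'), ∀ t ∈ Icc 0 T, u t p = w t p.1 p.2 := by
  have hM := hc.nonneg
  have hV := weightBound_nonneg hM hT
  have hle : ∀ t, mΩ.prod (ℱ t) ≤ mΩ.prod mΩ' := fun t =>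
    sup_le_sup le_rfl (MeasurableSpace.comap_mono (ℱ.le t))
  have hle2 : ∀ t, (mΩ.prod (ℱ t)).prod (mΩ.prod (ℱ t)) ≤ (mΩ.prod mΩ').prod (mΩ.prod mΩ') :=
    fun t => sup_le_sup (MeasurableSpace.comap_mono (hle t)) (MeasurableSpace.comap_mono (hle t))
  have hwb : ∀ᵐ p ∂(π.prod π').prod (π.prod π'), ∀ t ∈ Icc 0 T,
      |w t p.1 p.2| ≤ weightBound M T := by
    filter_upwards [h.w_continuous, h.w_eq, quasiMeasurePreserving_fst_pair.ae hi.w_bound]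
      with p h1 h2 h3 t ht
    exact abs_le_weightBound hM h1 h3 h2
      (fun s _ => abs_weightDrift_le hc (X s p.1) (X s p.2) _) ht
  obtain ⟨x, hxc, hxm, hx, -⟩ := exists_continuous_modification (P := π.prod π') hT
    (fun t ht => (h.X_adapted t ht).mono (hle t)) h.X_continuous (p := fun _ => True) (by simp)
  obtain ⟨u, huc, hum, hu, hu0⟩ := exists_continuous_modification
    (P := (π.prod π').prod (π.prod π')) hT
    (fun t ht => (h.w_adapted t ht).mono (hle2 t)) h.w_continuous hwb
  refine ⟨x, u, ⟨hxc, huc, hxm, hum, fun t p => ?_, ?_, ?_⟩, hx, hu⟩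
  · rcases hu0 p with h0 | ⟨h5, h6⟩
    · rw [h0, abs_zero]; exact hV
    · rw [h6]; exact h5 _ (Subtype.prop _)
  -- For almost every `a` the versions agree with the solution for almost every `b` at all times at
  -- once, so the mean interactions coincide at every time.
  · filter_upwards [h.X_eq, hx, Measure.ae_ae_of_ae_prod hu] with a h1 h2 h3 t ht
    rw [h2 t ht, h1 t ht]
    congr 3
    refine intervalIntegral_congr_of_forall_mem_Icc ht fun s hs => ?_
    rw [h2 s hs]
    congr 1
    refine integral_congr_ae ?_
    filter_upwards [hx, h3] with b h4 h5
    simp only [interaction]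
    rw [h2 s hs, h4 s hs, h5 s hs]
  · filter_upwards [h.w_eq, hu, Measure.quasiMeasurePreserving_fst.ae hx,
      Measure.quasiMeasurePreserving_snd.ae hx] with p h1 h2 h3 h4 t ht
    rw [h2 t ht, h1 t ht]
    congr 1
    refine intervalIntegral_congr_of_forall_mem_Icc ht fun s hs => ?_
    rw [h2 s hs, h3 s hs, h4 s hs, weightDrift]

namespace IsRegularMcKeanVlasovVersion

variable {x : ℝ → Ω × Ω' → StateSpace d k} {w : ℝ → (Ω × Ω') × (Ω × Ω') → ℝ}

omit [IsProbabilityMeasure π] [IsProbabilityMeasure π'] in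
theorem interaction_bound (h : IsRegularMcKeanVlasovVersion c π π' T B X₀ w₀ V x w)
    (hc : c.IsRegular M) (s : ℝ) (p : (Ω × Ω') × (Ω × Ω')) : ‖interaction c x w s p‖ ≤ V * M := by
  unfold interaction
  rw [norm_smul]
  exact mul_le_mul (h.w_bound s p) (hc.σ_bound _ _) (norm_nonneg _)
    ((abs_nonneg _).trans (h.w_bound s p))

omit [IsProbabilityMeasure π] [IsProbabilityMeasure π'] in
theorem interaction_continuous (h : IsRegularMcKeanVlasovVersion c π π' T B X₀ w₀ V x w)
    (hc : c.IsRegular M) (p : (Ω × Ω') × (Ω × Ω')) :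
    Continuous fun s => interaction c x w s p :=
  (h.w_continuous p).smul
    (hc.continuous_σ.comp ((h.x_continuous p.1).prodMk (h.x_continuous p.2)))

omit [IsProbabilityMeasure π] [IsProbabilityMeasure π'] in
theorem interaction_measurable (h : IsRegularMcKeanVlasovVersion c π π' T B X₀ w₀ V x w)
    (hc : c.IsRegular M) (s : ℝ) : StronglyMeasurable (interaction c x w s) :=
  (h.w_measurable s).smul (hc.continuous_σ.comp_stronglyMeasurable
    (((h.x_measurable s).comp_measurable measurable_fst).prodMk
      ((h.x_measurable s).comp_measurable measurable_snd)))

theorem meanInteraction_bound (h : IsRegularMcKeanVlasovVersion c π π' T B X₀ w₀ V x w)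
    (hc : c.IsRegular M) (s : ℝ) (a : Ω × Ω') :
    ‖∫ b, interaction c x w s (a, b) ∂π.prod π'‖ ≤ V * M := by
  simpa using norm_integral_le_of_norm_le_const (μ := π.prod π')
    (f := fun b => interaction c x w s (a, b))
    (Filter.Eventually.of_forall fun b => h.interaction_bound hc s (a, b))

/-- Dominated convergence, with the uniform bound `V * M`. -/
theorem meanInteraction_continuous (h : IsRegularMcKeanVlasovVersion c π π' T B X₀ w₀ V x w)
    (hc : c.IsRegular M) (a : Ω × Ω') :
    Continuous fun s => ∫ b, interaction c x w s (a, b) ∂π.prod π' :=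
  continuous_of_dominated (bound := fun _ => V * M)
    (fun s => ((h.interaction_measurable hc s).comp_measurable
      (by fun_prop : Measurable fun b => (a, b))).aestronglyMeasurable)
    (fun s => Filter.Eventually.of_forall fun b => h.interaction_bound hc s (a, b))
    (integrable_const _) (Filter.Eventually.of_forall fun b => h.interaction_continuous hc (a, b))

theorem meanInteraction_measurable (h : IsRegularMcKeanVlasovVersion c π π' T B X₀ w₀ V x w)
    (hc : c.IsRegular M) (s : ℝ) :
    StronglyMeasurable fun a => ∫ b, interaction c x w s (a, b) ∂π.prod π' :=
  StronglyMeasurable.integral_prod_right (f := fun a b => interaction c x w s (a, b))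
    (h.interaction_measurable hc s)

end IsRegularMcKeanVlasovVersion

end RegularVersions

/-! ### Comparison of the two systems in mean. -/

section Comparison

variable {d : ℕ} {k : StateSpaceKind} {Ω Ω' : Type*} [mΩ : MeasurableSpace Ω]
  [mΩ' : MeasurableSpace Ω'] {c : Coefficients d k} {M V : ℝ} {π : Measure Ω}
  [IsProbabilityMeasure π] {π' : Measure Ω'} [IsProbabilityMeasure π'] {N : ℕ}
  {πs : Fin N → Measure Ω} {T : ℝ}
  {B : ℝ → Ω' → EuclideanSpace ℝ (Fin d)} {X₀ : Ω → StateSpace d k} {w₀ : Ω → Ω → ℝ}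
  {x : Fin N → ℝ → (Fin N → Ω × Ω') → StateSpace d k}
  {w : Fin N → Fin N → ℝ → (Fin N → Ω × Ω') → ℝ}
  {y : ℝ → Ω × Ω' → StateSpace d k} {v : ℝ → (Ω × Ω') × (Ω × Ω') → ℝ}

/-- The difference between the drift of the `i`-th agent and of its McKean–Vlasov counterpart. -/
def driftError (c : Coefficients d k) (π : Measure Ω) (π' : Measure Ω')
    (x : Fin N → ℝ → (Fin N → Ω × Ω') → StateSpace d k)
    (w : Fin N → Fin N → ℝ → (Fin N → Ω × Ω') → ℝ) (y : ℝ → Ω × Ω' → StateSpace d k)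
    (v : ℝ → (Ω × Ω') × (Ω × Ω') → ℝ) (i : Fin N) (s : ℝ) (a : Fin N → Ω × Ω') :
    EuclideanSpace ℝ (Fin d) :=
  agentDrift c (fun j => x j s a) (fun j l => w j l s a) i
    - (c.μ (y s (a i)) + ∫ b, interaction c y v s (a i, b) ∂π.prod π')

/-- The difference between the drift of a weight and of its McKean–Vlasov counterpart. -/
def weightError (c : Coefficients d k) (x : Fin N → ℝ → (Fin N → Ω × Ω') → StateSpace d k)
    (w : Fin N → Fin N → ℝ → (Fin N → Ω × Ω') → ℝ) (y : ℝ → Ω × Ω' → StateSpace d k)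
    (v : ℝ → (Ω × Ω') × (Ω × Ω') → ℝ) (i j : Fin N) (s : ℝ) (a : Fin N → Ω × Ω') : ℝ :=
  weightDrift c (x i s a) (x j s a) (w i j s a)
    - weightDrift c (y s (a i)) (y s (a j)) (v s (a i, a j))

section DriftError

theorem continuous_driftError (hc : c.IsRegular M)
    (hx : IsRegularAgentVersion c πs π' T B X₀ w₀ V x w)
    (hy : IsRegularMcKeanVlasovVersion c π π' T B X₀ w₀ V y v) (i : Fin N) (a : Fin N → Ω × Ω') :
    Continuous fun s => driftError c π π' x w y v i s a := by
  have h1 : Continuous fun s => agentDrift c (fun j => x j s a) (fun j l => w j l s a) i :=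
    (continuous_apply i).comp ((continuous_agentDrift hc).comp
      ((continuous_pi fun j => hx.x_continuous j a).prodMk
        (continuous_pi fun j => continuous_pi fun l => hx.w_continuous j l a)))
  exact h1.sub ((hc.continuous_μ.comp (hy.x_continuous (a i))).add
    (hy.meanInteraction_continuous hc (a i)))

theorem stronglyMeasurable_agentDrift (hc : c.IsRegular M) {A : Type*} [MeasurableSpace A]
    {p : Fin N → A → StateSpace d k} {q : Fin N → Fin N → A → ℝ}
    (hp : ∀ i, StronglyMeasurable (p i)) (hq : ∀ i j, StronglyMeasurable (q i j)) (i : Fin N) :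
    StronglyMeasurable fun a => agentDrift c (fun j => p j a) (fun j l => q j l a) i := by
  unfold agentDrift
  exact (hc.continuous_μ.comp_stronglyMeasurable (hp i)).add
    ((Finset.stronglyMeasurable_fun_sum _ fun j _ => (hq i j).smul
      (hc.continuous_σ.comp_stronglyMeasurable ((hp i).prodMk (hp j)))).const_smul (N : ℝ)⁻¹)

theorem stronglyMeasurable_driftError (hc : c.IsRegular M)
    (hx : IsRegularAgentVersion c πs π' T B X₀ w₀ V x w)
    (hy : IsRegularMcKeanVlasovVersion c π π' T B X₀ w₀ V y v) (i : Fin N) (s : ℝ) :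
    StronglyMeasurable (driftError c π π' x w y v i s) := by
  unfold driftError
  exact (stronglyMeasurable_agentDrift hc (fun j => hx.x_measurable j s)
    (fun j l => hx.w_measurable j l s) i).sub
    ((hc.continuous_μ.comp_stronglyMeasurable
      ((hy.x_measurable s).comp_measurable (measurable_pi_apply i))).add
      ((hy.meanInteraction_measurable hc s).comp_measurable (measurable_pi_apply i)))

theorem norm_driftError_le (hc : c.IsRegular M) (hV : 0 ≤ V)
    (hx : IsRegularAgentVersion c πs π' T B X₀ w₀ V x w)
    (hy : IsRegularMcKeanVlasovVersion c π π' T B X₀ w₀ V y v) (i : Fin N) (s : ℝ)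
    (a : Fin N → Ω × Ω') : ‖driftError c π π' x w y v i s a‖ ≤ 2 * (M + V * M) := by
  unfold driftError
  have h1 := norm_agentDrift_le hc hV (x := fun j => x j s a) (w := fun j l => w j l s a) i
    fun j _ => hx.w_bound i j s a
  have h2 := (norm_add_le (c.μ (y s (a i))) (∫ b, interaction c y v s (a i, b) ∂π.prod π')).trans
    (add_le_add (hc.μ_bound _) (hy.meanInteraction_bound hc s (a i)))
  exact (norm_sub_le _ _).trans (by linarith)

/-- Initial state and noise cancel, leaving the projection of a time integral. -/
theorem ae_sub_eq_proj_integral_driftError (hc : c.IsRegular M) (hπ : IsIndependentMixture π πs)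
    (hx : IsRegularAgentVersion c πs π' T B X₀ w₀ V x w)
    (hy : IsRegularMcKeanVlasovVersion c π π' T B X₀ w₀ V y v) (i : Fin N) :
    ∀ᵐ a ∂mixtureMeasure πs π', ∀ t ∈ Icc 0 T, x i t a - y t (a i)
      = StateSpace.proj d k (∫ s in (0 : ℝ)..t, driftError c π π' x w y v i s a) := by
  filter_upwards [hx.x_eq i, (hπ.quasiMeasurePreserving_eval i).ae hy.x_eq] with a h1 h2 t ht
  have h3 : Continuous fun s => agentDrift c (fun j => x j s a) (fun j l => w j l s a) i :=
    (continuous_apply i).comp ((continuous_agentDrift hc).comp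
      ((continuous_pi fun j => hx.x_continuous j a).prodMk
        (continuous_pi fun j => continuous_pi fun l => hx.w_continuous j l a)))
  have h4 : Continuous fun s => c.μ (y s (a i)) + ∫ b, interaction c y v s (a i, b) ∂π.prod π' :=
    (hc.continuous_μ.comp (hy.x_continuous (a i))).add (hy.meanInteraction_continuous hc (a i))
  unfold driftError
  rw [intervalIntegral.integral_sub (h3.intervalIntegrable _ _) (h4.intervalIntegrable _ _),
    h1 t ht, h2 t ht, add_sub_add_left_eq_sub, ← map_sub, add_sub_add_right_eq_sub]

omit [IsProbabilityMeasure π] [IsProbabilityMeasure π'] in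
theorem continuous_weightError (hc : c.IsRegular M)
    (hx : IsRegularAgentVersion c πs π' T B X₀ w₀ V x w)
    (hy : IsRegularMcKeanVlasovVersion c π π' T B X₀ w₀ V y v) (i j : Fin N)
    (a : Fin N → Ω × Ω') : Continuous fun s => weightError c x w y v i j s a :=
  ((continuous_weightDrift hc).comp ((hx.x_continuous i a).prodMk
    ((hx.x_continuous j a).prodMk (hx.w_continuous i j a)))).sub
    ((continuous_weightDrift hc).comp ((hy.x_continuous (a i)).prodMk
      ((hy.x_continuous (a j)).prodMk (hy.w_continuous (a i, a j)))))

omit [IsProbabilityMeasure π] [IsProbabilityMeasure π'] in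
theorem stronglyMeasurable_weightError (hc : c.IsRegular M)
    (hx : IsRegularAgentVersion c πs π' T B X₀ w₀ V x w)
    (hy : IsRegularMcKeanVlasovVersion c π π' T B X₀ w₀ V y v) (i j : Fin N) (s : ℝ) :
    StronglyMeasurable (weightError c x w y v i j s) :=
  ((continuous_weightDrift hc).comp_stronglyMeasurable ((hx.x_measurable i s).prodMk
    ((hx.x_measurable j s).prodMk (hx.w_measurable i j s)))).sub
    ((continuous_weightDrift hc).comp_stronglyMeasurable
      (((hy.x_measurable s).comp_measurable (measurable_pi_apply i)).prodMk
        (((hy.x_measurable s).comp_measurable (measurable_pi_apply j)).prodMk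
          ((hy.w_measurable s).comp_measurable
            ((measurable_pi_apply i).prodMk (measurable_pi_apply j))))))

omit [IsProbabilityMeasure π] [IsProbabilityMeasure π'] in
theorem abs_weightError_le (hc : c.IsRegular M)
    (hx : IsRegularAgentVersion c πs π' T B X₀ w₀ V x w)
    (hy : IsRegularMcKeanVlasovVersion c π π' T B X₀ w₀ V y v) (i j : Fin N) (s : ℝ)
    (a : Fin N → Ω × Ω') : |weightError c x w y v i j s a| ≤ 2 * (M * V + M) := by
  unfold weightError
  have hM := hc.nonneg
  have h1 := abs_weightDrift_le hc (x i s a) (x j s a) (w i j s a)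
  have h2 := abs_weightDrift_le hc (y s (a i)) (y s (a j)) (v s (a i, a j))
  have h3 := mul_le_mul_of_nonneg_left (hx.w_bound i j s a) hM
  have h4 := mul_le_mul_of_nonneg_left (hy.w_bound s (a i, a j)) hM
  exact (abs_sub _ _).trans (by linarith)

theorem ae_sub_eq_integral_weightError (hc : c.IsRegular M) (hπ : IsIndependentMixture π πs)
    (hx : IsRegularAgentVersion c πs π' T B X₀ w₀ V x w)
    (hy : IsRegularMcKeanVlasovVersion c π π' T B X₀ w₀ V y v) {i j : Fin N} (hij : i ≠ j) :
    ∀ᵐ a ∂mixtureMeasure πs π', ∀ t ∈ Icc 0 T, w i j t a - v t (a i, a j)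
      = ∫ s in (0 : ℝ)..t, weightError c x w y v i j s a := by
  filter_upwards [hx.w_eq i j hij, (hπ.quasiMeasurePreserving_eval_pair hij).ae hy.w_eq]
    with a h1 h2 t ht
  have h3 : Continuous fun s => weightDrift c (x i s a) (x j s a) (w i j s a) :=
    (continuous_weightDrift hc).comp ((hx.x_continuous i a).prodMk
      ((hx.x_continuous j a).prodMk (hx.w_continuous i j a)))
  have h4 : Continuous fun s => weightDrift c (y s (a i)) (y s (a j)) (v s (a i, a j)) :=
    (continuous_weightDrift hc).comp ((hy.x_continuous (a i)).prodMk
      ((hy.x_continuous (a j)).prodMk (hy.w_continuous (a i, a j))))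
  unfold weightError
  rw [intervalIntegral.integral_sub (h3.intervalIntegrable _ _) (h4.intervalIntegrable _ _),
    h1 t ht, h2 t ht, add_sub_add_left_eq_sub]

/-- This deterministic bound makes the errors integrable and starts the Grönwall iteration without
using the size of the states themselves. -/
theorem ae_norm_sub_le (hc : c.IsRegular M) (hV : 0 ≤ V) (hπ : IsIndependentMixture π πs)
    (hx : IsRegularAgentVersion c πs π' T B X₀ w₀ V x w)
    (hy : IsRegularMcKeanVlasovVersion c π π' T B X₀ w₀ V y v) (i : Fin N) :
    ∀ᵐ a ∂mixtureMeasure πs π', ∀ t ∈ Icc 0 T, ‖x i t a - y t (a i)‖ ≤ 2 * (M + V * M) * T := by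
  have hM := hc.nonneg
  filter_upwards [ae_sub_eq_proj_integral_driftError hc hπ hx hy i] with a ha t ht
  rw [ha t ht]
  refine (StateSpace.norm_proj_le _).trans ((intervalIntegral.norm_integral_le_of_norm_le_const
    fun s _ => norm_driftError_le hc hV hx hy i s a).trans ?_)
  rw [sub_zero, abs_of_nonneg ht.1]
  exact mul_le_mul_of_nonneg_left ht.2 (by positivity)

theorem integrable_norm_sub (hc : c.IsRegular M) (hV : 0 ≤ V) (hπ : IsIndependentMixture π πs)
    (hx : IsRegularAgentVersion c πs π' T B X₀ w₀ V x w)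
    (hy : IsRegularMcKeanVlasovVersion c π π' T B X₀ w₀ V y v) (i : Fin N) {t : ℝ}
    (ht : t ∈ Icc 0 T) :
    Integrable (fun a => ‖x i t a - y t (a i)‖) (mixtureMeasure πs π') := by
  have := hπ.isProbabilityMeasure_mixture (π' := π')
  refine Integrable.of_bound ((hx.x_measurable i t).sub ((hy.x_measurable t).comp_measurable
    (measurable_pi_apply i))).norm.aestronglyMeasurable (2 * (M + V * M) * T) ?_
  filter_upwards [ae_norm_sub_le hc hV hπ hx hy i] with a ha
  rw [norm_norm]
  exact ha t ht

omit [IsProbabilityMeasure π] [IsProbabilityMeasure π'] in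
theorem abs_sub_weight_le (hx : IsRegularAgentVersion c πs π' T B X₀ w₀ V x w)
    (hy : IsRegularMcKeanVlasovVersion c π π' T B X₀ w₀ V y v) (i j : Fin N) (t : ℝ)
    (a : Fin N → Ω × Ω') : |w i j t a - v t (a i, a j)| ≤ 2 * V :=
  (abs_sub _ _).trans (by linarith [hx.w_bound i j t a, hy.w_bound t (a i, a j)])

omit [IsProbabilityMeasure π] in
theorem integrable_abs_sub_weight (hπ : IsIndependentMixture π πs)
    (hx : IsRegularAgentVersion c πs π' T B X₀ w₀ V x w)
    (hy : IsRegularMcKeanVlasovVersion c π π' T B X₀ w₀ V y v) (i j : Fin N) (t : ℝ) :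
    Integrable (fun a => |w i j t a - v t (a i, a j)|) (mixtureMeasure πs π') := by
  have := hπ.isProbabilityMeasure_mixture (π' := π')
  refine Integrable.of_bound ((hx.w_measurable i j t).sub ((hy.w_measurable t).comp_measurable
    ((measurable_pi_apply i).prodMk (measurable_pi_apply j)))).norm.aestronglyMeasurable (2 * V)
    (Filter.Eventually.of_forall fun a => ?_)
  rw [Real.norm_eq_abs, abs_abs]
  exact abs_sub_weight_le hx hy i j t a

theorem integral_const_mul_add_const_mul_add {A : Type*} [MeasurableSpace A] {Q : Measure A}
    {f g h : A → ℝ} (hf : Integrable f Q) (hg : Integrable g Q) (hh : Integrable h Q) (p q : ℝ) :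
    ∫ a, (p * f a + q * (g a + h a)) ∂Q
      = p * ∫ a, f a ∂Q + q * (∫ a, g a ∂Q + ∫ a, h a ∂Q) := by
  have h1 : Integrable (fun a => g a + h a) Q := hg.add hh
  rw [integral_add (hf.const_mul p) (h1.const_mul q), integral_const_mul, integral_const_mul,
    integral_add hg hh]

theorem integrable_empirical_sub_mean (hc : c.IsRegular M) (hV : 0 ≤ V)
    (hπ : IsIndependentMixture π πs)
    (hy : IsRegularMcKeanVlasovVersion c π π' T B X₀ w₀ V y v) (i : Fin N) (s : ℝ) :
    Integrable (fun a => ‖(N : ℝ)⁻¹ • ∑ j ∈ Finset.univ.erase i,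
      interaction c y v s (a i, a j) - ∫ b, interaction c y v s (a i, b) ∂π.prod π'‖)
      (mixtureMeasure πs π') := by
  have := hπ.isProbabilityMeasure_mixture (π' := π')
  have hM := hc.nonneg
  have h1 : ∀ j, StronglyMeasurable fun a : Fin N → Ω × Ω' => interaction c y v s (a i, a j) :=
    fun j => (hy.interaction_measurable hc s).comp_measurable
      ((measurable_pi_apply i).prodMk (measurable_pi_apply j))
  have h2 : StronglyMeasurable fun a : Fin N → Ω × Ω' =>
      ∑ j ∈ Finset.univ.erase i, interaction c y v s (a i, a j) :=
    Finset.stronglyMeasurable_fun_sum _ fun j _ => h1 j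
  have h3 : StronglyMeasurable fun a : Fin N → Ω × Ω' =>
      ∫ b, interaction c y v s (a i, b) ∂π.prod π' :=
    (hy.meanInteraction_measurable hc s).comp_measurable (measurable_pi_apply i)
  refine (Integrable.of_bound ((h2.const_smul (N : ℝ)⁻¹).sub h3).aestronglyMeasurable
    (V * M + V * M) (Filter.Eventually.of_forall fun a => ?_)).norm
  refine (norm_sub_le _ _).trans (add_le_add ((norm_inv_smul_sum_erase_le i _).trans
    (average_erase_le (by positivity) i fun j _ => ?_)) (hy.meanInteraction_bound hc s (a i)))
  exact hy.interaction_bound hc s (a i, a j)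

/-- The rate constant of the law of large numbers for interactions bounded by `K`. -/
def fluctuationConstant (K : ℝ) : ℝ := (4 * K ^ 2 + 1) / 2 + K

/-- The law of large numbers is applied only to interactions of sampled agents, which are
independent; the agents of the system itself are not. -/
theorem integral_norm_driftError_le (hc : c.IsRegular M) (hV : 0 ≤ V)
    (hπ : IsIndependentMixture π πs) (hx : IsRegularAgentVersion c πs π' T B X₀ w₀ V x w)
    (hy : IsRegularMcKeanVlasovVersion c π π' T B X₀ w₀ V y v) (i : Fin N) {s r : ℝ}
    (hs : s ∈ Icc 0 T) (hr : 0 ≤ r)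
    (hxr : ∀ j, ∫ a, ‖x j s a - y s (a j)‖ ∂mixtureMeasure πs π' ≤ r)
    (hwr : ∀ j, i ≠ j → ∫ a, |w i j s a - v s (a i, a j)| ∂mixtureMeasure πs π' ≤ r) :
    ∫ a, ‖driftError c π π' x w y v i s a‖ ∂mixtureMeasure πs π'
      ≤ (2 * M + 2 * V * M) * r + fluctuationConstant (V * M) * (√N)⁻¹ := by
  have := hπ.isProbabilityMeasure_mixture (π' := π')
  have hM := hc.nonneg
  set Q := mixtureMeasure πs π' with hQ
  let g : Fin N → (Fin N → Ω × Ω') → ℝ := fun j a => M * |w i j s a - v s (a i, a j)|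
    + V * M * (‖x i s a - y s (a i)‖ + ‖x j s a - y s (a j)‖)
  let ρ : (Fin N → Ω × Ω') → ℝ := fun a => ‖(N : ℝ)⁻¹ • ∑ j ∈ Finset.univ.erase i,
    interaction c y v s (a i, a j) - ∫ b, interaction c y v s (a i, b) ∂π.prod π'‖
  have hpt : ∀ a, ‖driftError c π π' x w y v i s a‖ ≤ (M * ‖x i s a - y s (a i)‖
      + (N : ℝ)⁻¹ * ∑ j ∈ Finset.univ.erase i, g j a) + ρ a := by
    intro a
    have h1 := norm_agentDrift_sub_le hc (x := fun j => x j s a) (y := fun j => y s (a j))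
      (w := fun j l => w j l s a) (v := fun j l => v s (a j, a l)) i
      fun j _ => hy.w_bound s (a i, a j)
    -- The intermediate term is the agent drift at the sampled configuration; subtracting it leaves
    -- the Lipschitz error and the empirical error.
    have h2 : driftError c π π' x w y v i s a
        = (agentDrift c (fun j => x j s a) (fun j l => w j l s a) i
          - agentDrift c (fun j => y s (a j)) (fun j l => v s (a j, a l)) i)
          + ((N : ℝ)⁻¹ • ∑ j ∈ Finset.univ.erase i, interaction c y v s (a i, a j)
            - ∫ b, interaction c y v s (a i, b) ∂π.prod π') := by
      simp only [driftError, agentDrift, interaction]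
      abel
    rw [h2]
    simp only [← mul_assoc V M] at h1
    exact (norm_add_le _ _).trans (add_le_add h1 le_rfl)
  have hix : ∀ j, Integrable (fun a => ‖x j s a - y s (a j)‖) Q := fun j =>
    integrable_norm_sub hc hV hπ hx hy j hs
  have hiw : ∀ j, Integrable (fun a => |w i j s a - v s (a i, a j)|) Q := fun j =>
    integrable_abs_sub_weight hπ hx hy i j s
  have hig : ∀ j, Integrable (g j) Q := fun j =>
    ((hiw j).const_mul M).add (((hix i).add (hix j)).const_mul (V * M))
  have hiρ : Integrable ρ Q := integrable_empirical_sub_mean hc hV hπ hy i s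
  have hgr : ∀ j, j ≠ i → ∫ a, g j a ∂Q ≤ (M + 2 * V * M) * r := by
    intro j hj
    simp only [g]
    rw [integral_const_mul_add_const_mul_add (hiw j) (hix i) (hix j)]
    have h1 := mul_le_mul_of_nonneg_left (hwr j hj.symm) hM
    have h2 := mul_le_mul_of_nonneg_left (add_le_add (hxr i) (hxr j)) (mul_nonneg hV hM)
    linarith
  have hisum : Integrable (fun a => (N : ℝ)⁻¹ * ∑ j ∈ Finset.univ.erase i, g j a) Q :=
    (integrable_finsetSum _ fun j _ => hig j).const_mul _
  have hitot : Integrable (fun a => M * ‖x i s a - y s (a i)‖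
      + (N : ℝ)⁻¹ * ∑ j ∈ Finset.univ.erase i, g j a) Q := ((hix i).const_mul M).add hisum
  refine (integral_mono_of_nonneg (Filter.Eventually.of_forall fun a => norm_nonneg _)
    (hitot.add hiρ) (Filter.Eventually.of_forall hpt)).trans ?_
  simp only [Pi.add_apply]
  rw [integral_add hitot hiρ]
  refine add_le_add ?_ (hπ.integral_norm_empirical_sub_le (hy.interaction_measurable hc s)
    (hy.interaction_bound hc s) i)
  rw [integral_add ((hix i).const_mul M) hisum, integral_const_mul, integral_const_mul,
    integral_finsetSum _ fun j _ => hig j]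
  have h1 := average_erase_le (by positivity) i hgr
  have h2 := mul_le_mul_of_nonneg_left (hxr i) hM
  linarith

theorem integral_abs_weightError_le (hc : c.IsRegular M) (hV : 0 ≤ V)
    (hπ : IsIndependentMixture π πs) (hx : IsRegularAgentVersion c πs π' T B X₀ w₀ V x w)
    (hy : IsRegularMcKeanVlasovVersion c π π' T B X₀ w₀ V y v) (i j : Fin N) {s r : ℝ}
    (hs : s ∈ Icc 0 T)
    (hxr : ∀ j, ∫ a, ‖x j s a - y s (a j)‖ ∂mixtureMeasure πs π' ≤ r)
    (hwr : ∫ a, |w i j s a - v s (a i, a j)| ∂mixtureMeasure πs π' ≤ r) :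
    ∫ a, |weightError c x w y v i j s a| ∂mixtureMeasure πs π' ≤ (3 * M + 2 * V * M) * r := by
  have hM := hc.nonneg
  have hix := fun j => integrable_norm_sub hc hV hπ hx hy j hs
  have hiw := integrable_abs_sub_weight hπ hx hy i j s
  refine (integral_mono_of_nonneg (Filter.Eventually.of_forall fun a => abs_nonneg _)
    ((hiw.const_mul M).add (((hix i).add (hix j)).const_mul (V * M + M)))
    (Filter.Eventually.of_forall fun a =>
      abs_weightDrift_sub_le hc (hy.w_bound s (a i, a j)))).trans ?_
  simp only [Pi.add_apply]
  rw [integral_const_mul_add_const_mul_add hiw (hix i) (hix j)]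
  have h1 := mul_le_mul_of_nonneg_left hwr hM
  have h2 := mul_le_mul_of_nonneg_left (add_le_add (hxr i) (hxr j))
    (by positivity : 0 ≤ V * M + M)
  linarith

end DriftError

/-- The `L¹` distances between the agent system and the sampled McKean–Vlasov system. -/
theorem comparison_estimate (hc : c.IsRegular M) (hV : 0 ≤ V) (hT : 0 ≤ T)
    (hπ : IsIndependentMixture π πs) (hx : IsRegularAgentVersion c πs π' T B X₀ w₀ V x w)
    (hy : IsRegularMcKeanVlasovVersion c π π' T B X₀ w₀ V y v) :
    ∀ t ∈ Icc 0 T,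
      (∀ i, ∫ a, ‖x i t a - y t (a i)‖ ∂mixtureMeasure πs π' ≤
        T * (fluctuationConstant (V * M) * (√N)⁻¹) * Real.exp ((3 * M + 2 * V * M) * t)) ∧
      ∀ i j, i ≠ j → ∫ a, |w i j t a - v t (a i, a j)| ∂mixtureMeasure πs π' ≤
        T * (fluctuationConstant (V * M) * (√N)⁻¹) * Real.exp ((3 * M + 2 * V * M) * t) := by
  classical
  have := hπ.isProbabilityMeasure_mixture (π' := π')
  have hM := hc.nonneg
  set Q := mixtureMeasure πs π' with hQ
  set κ : ℝ := fluctuationConstant (V * M) * (√N)⁻¹ with hκ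
  have hκ0 : 0 ≤ κ := by
    rw [hκ, fluctuationConstant]; positivity
  have hL : 0 ≤ 3 * M + 2 * V * M := by positivity
  -- States and weights are estimated together because each error feeds the other; diagonal weights
  -- contribute 0.
  let e : Fin N ⊕ Fin N × Fin N → ℝ → ℝ := fun q t =>
    q.elim (fun i => ∫ a, ‖x i t a - y t (a i)‖ ∂Q)
      (fun p => if p.1 = p.2 then 0 else ∫ a, |w p.1 p.2 t a - v t (a p.1, a p.2)| ∂Q)
  have hb1 : 0 ≤ 2 * (M + V * M) * T := by positivity
  have hbdd : ∀ q, ∀ t ∈ Icc 0 T, e q t ≤ 2 * (M + V * M) * T + 2 * V := by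
    rintro (i | ⟨i, j⟩) t ht
    · simp only [e, Sum.elim_inl]
      refine (integral_mono_ae (integrable_norm_sub hc hV hπ hx hy i ht)
        (integrable_const (2 * (M + V * M) * T)) ?_).trans ?_
      · filter_upwards [ae_norm_sub_le hc hV hπ hx hy i] with a ha using ha t ht
      · simp; linarith
    · by_cases hij : i = j
      · simp only [e, Sum.elim_inr, if_pos hij]; positivity
      · simp only [e, Sum.elim_inr, if_neg hij]
        refine (integral_mono (integrable_abs_sub_weight hπ hx hy i j t)
          (integrable_const (2 * V)) (fun a => abs_sub_weight_le hx hy i j t a)).trans ?_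
        simp; linarith
  have key := gronwall_of_forall_majorant (e := e) (T := T) (A := T * κ)
    (L := 3 * M + 2 * V * M) hL (by positivity) (by positivity) hbdd ?_
  · intro t ht
    refine ⟨fun i => key (Sum.inl i) t ht, fun i j hij => ?_⟩
    simpa only [e, Sum.elim_inr, if_neg hij] using key (Sum.inr (i, j)) t ht
  -- Only the state equation produces the source term `κ`. Its integral up to `t` is at most `T *
  -- κ`, the constant given to Grönwall.
  intro φ hφ hφ0 heφ q t ht
  have hsub : ∀ s ∈ Icc 0 t, s ∈ Icc 0 T := fun s hs => ⟨hs.1, hs.2.trans ht.2⟩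
  have hxφ : ∀ s ∈ Icc 0 T, ∀ i, ∫ a, ‖x i s a - y s (a i)‖ ∂Q ≤ φ s :=
    fun s hs i => heφ (Sum.inl i) s hs
  have hwφ : ∀ s ∈ Icc 0 T, ∀ i j, i ≠ j → ∫ a, |w i j s a - v s (a i, a j)| ∂Q ≤ φ s :=
    fun s hs i j hij => by
      simpa only [e, Sum.elim_inr, if_neg hij] using heφ (Sum.inr (i, j)) s hs
  have hint0 : 0 ≤ (3 * M + 2 * V * M) * ∫ s in (0 : ℝ)..t, φ s :=
    mul_nonneg hL (intervalIntegral.integral_nonneg ht.1 fun s hs => hφ0 s (hsub s hs))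
  have hTκ : 0 ≤ T * κ := by positivity
  rcases q with i | ⟨i, j⟩
  · have h1 := integral_le_intervalIntegral_of_forall_integral_le (Q := Q)
      (f := fun s a => ‖driftError c π π' x w y v i s a‖)
      (h := fun a => ‖x i t a - y t (a i)‖) (φ := fun s => (3 * M + 2 * V * M) * φ s + κ)
      (K := 2 * (M + V * M)) ht.1
      (fun a => (continuous_driftError hc hx hy i a).norm)
      (fun s => (stronglyMeasurable_driftError hc hx hy i s).norm)
      (fun s a => by rw [abs_norm]; exact norm_driftError_le hc hV hx hy i s a)
      (integrable_norm_sub hc hV hπ hx hy i ht) (by fun_prop)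
      (by
        filter_upwards [ae_sub_eq_proj_integral_driftError hc hπ hx hy i] with a ha
        rw [ha t ht]
        exact (StateSpace.norm_proj_le _).trans
          (intervalIntegral.norm_integral_le_integral_norm ht.1))
      (fun s hs => by
        have hs' := hsub s hs
        refine (integral_norm_driftError_le hc hV hπ hx hy i hs' (hφ0 s hs') (hxφ s hs')
          (fun j hij => hwφ s hs' i j hij)).trans ?_
        have := mul_nonneg hM (hφ0 s hs')
        linarith)
    rw [intervalIntegral.integral_add ((hφ.const_mul _).intervalIntegrable _ _) (by simp),
      intervalIntegral.integral_const_mul, intervalIntegral.integral_const, sub_zero,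
      smul_eq_mul] at h1
    refine h1.trans ?_
    have := mul_le_mul_of_nonneg_right ht.2 hκ0
    linarith
  · by_cases hij : i = j
    · simp only [e, Sum.elim_inr, if_pos hij]
      positivity
    · simp only [e, Sum.elim_inr, if_neg hij]
      have h1 := integral_le_intervalIntegral_of_forall_integral_le (Q := Q)
        (f := fun s a => |weightError c x w y v i j s a|)
        (h := fun a => |w i j t a - v t (a i, a j)|) (φ := fun s => (3 * M + 2 * V * M) * φ s)
        (K := 2 * (M * V + M)) ht.1
        (fun a => (continuous_weightError hc hx hy i j a).abs)
        (fun s => (stronglyMeasurable_weightError hc hx hy i j s).norm)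
        (fun s a => by rw [abs_abs]; exact abs_weightError_le hc hx hy i j s a)
        (integrable_abs_sub_weight hπ hx hy i j t) (by fun_prop)
        (by
          filter_upwards [ae_sub_eq_integral_weightError hc hπ hx hy hij] with a ha
          rw [ha t ht]
          exact intervalIntegral.abs_integral_le_integral_abs ht.1)
        (fun s hs => integral_abs_weightError_le hc hV hπ hx hy i j (hsub s hs)
          (hxφ s (hsub s hs)) (hwφ s (hsub s hs) i j hij))
      rw [intervalIntegral.integral_const_mul] at h1
      linarith

end Comparison

/-! ### Localization in time and the final constant. -/

section Main

variable {d : ℕ} {k : StateSpaceKind} {Ω Ω' : Type*} [mΩ : MeasurableSpace Ω]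
  [mΩ' : MeasurableSpace Ω'] {c : Coefficients d k} {M : ℝ} {π : Measure Ω} {π' : Measure Ω'}
  {N : ℕ} {πs : Fin N → Measure Ω} {ℱ : Filtration ℝ mΩ'} {T T' : ℝ}
  {B : ℝ → Ω' → EuclideanSpace ℝ (Fin d)} {X₀ : Ω → StateSpace d k} {w₀ : Ω → Ω → ℝ}

/-- Restricting the horizon to the evaluation time makes the constant depend on `t` rather than on
`T`. -/
theorem IsAgentSolution.mono_time {X : Fin N → ℝ → (Fin N → Ω × Ω') → StateSpace d k}
    {w : Fin N → Fin N → ℝ → (Fin N → Ω × Ω') → ℝ} (h : IsAgentSolution c πs π' ℱ T B X₀ w₀ X w)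
    (hT : T' ≤ T) : IsAgentSolution c πs π' ℱ T' B X₀ w₀ X w := by
  have hI : Icc 0 T' ⊆ Icc 0 T := Icc_subset_Icc_right hT
  exact ⟨fun i t ht => h.X_adapted i t (hI ht), fun i j hij t ht => h.w_adapted i j hij t (hI ht),
    fun i => (h.X_continuous i).mono fun a ha => ha.mono hI,
    fun i j hij => (h.w_continuous i j hij).mono fun a ha => ha.mono hI, h.X_init, h.w_init,
    fun i => (h.X_eq i).mono fun a ha t ht => ha t (hI ht),
    fun i j hij => (h.w_eq i j hij).mono fun a ha t ht => ha t (hI ht)⟩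

theorem IsMcKeanVlasovSolution.mono_time {X : ℝ → Ω × Ω' → StateSpace d k}
    {w : ℝ → Ω × Ω' → Ω × Ω' → ℝ} (h : IsMcKeanVlasovSolution c π π' ℱ T B X₀ w₀ X w)
    (hT : T' ≤ T) : IsMcKeanVlasovSolution c π π' ℱ T' B X₀ w₀ X w := by
  have hI : Icc 0 T' ⊆ Icc 0 T := Icc_subset_Icc_right hT
  exact ⟨fun t ht => h.X_adapted t (hI ht), fun t ht => h.w_adapted t (hI ht),
    fun t ht => h.X_moment t (hI ht), fun t ht => h.w_moment t (hI ht),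
    h.X_continuous.mono fun a ha => ha.mono hI, h.w_continuous.mono fun a ha => ha.mono hI,
    h.X_eq.mono fun a ha t ht => ha t (hI ht), h.w_eq.mono fun a ha t ht => ha t (hI ht)⟩

/-- The constant of the propagation of independence estimate. -/
def propagationConstant (M t : ℝ) : ℝ :=
  -- The summand 1 and the absolute value make the constant positive for all real `M` and `t`,
  -- including negative ones.
  1 + |t * fluctuationConstant (weightBound M t * M)
    * Real.exp ((3 * M + 2 * weightBound M t * M) * t)|

theorem propagationConstant_pos (M t : ℝ) : 0 < propagationConstant M t := by
  unfold propagationConstant; positivity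

theorem propagation_estimate [IsProbabilityMeasure π] [IsProbabilityMeasure π']
    (hc : c.IsRegular M) (hi : IsInitialTriplet π X₀ w₀ M) (hπ : IsIndependentMixture π πs)
    {X : Fin N → ℝ → (Fin N → Ω × Ω') → StateSpace d k}
    {w : Fin N → Fin N → ℝ → (Fin N → Ω × Ω') → ℝ} {Y : ℝ → Ω × Ω' → StateSpace d k}
    {v : ℝ → Ω × Ω' → Ω × Ω' → ℝ} (hX : IsAgentSolution c πs π' ℱ T B X₀ w₀ X w)
    (hY : IsMcKeanVlasovSolution c π π' ℱ T B X₀ w₀ Y v) {t : ℝ} (ht : t ∈ Icc 0 T) :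
    (∀ i, Integrable (fun a => ‖X i t a - Y t (a i)‖) (mixtureMeasure πs π') ∧
      ∫ a, ‖X i t a - Y t (a i)‖ ∂mixtureMeasure πs π'
        ≤ propagationConstant M t * (N : ℝ) ^ (-(1 / 2) : ℝ)) ∧
    (∀ i j, i ≠ j →
      Integrable (fun a => |w i j t a - v t (a i) (a j)|) (mixtureMeasure πs π') ∧
      ∫ a, |w i j t a - v t (a i) (a j)| ∂mixtureMeasure πs π'
        ≤ propagationConstant M t * (N : ℝ) ^ (-(1 / 2) : ℝ)) := by
  have hV := weightBound_nonneg hc.nonneg ht.1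
  have htt : t ∈ Icc 0 t := ⟨ht.1, le_rfl⟩
  -- Both systems are restricted to `[0,t]` before regular versions are taken, so the weight bound
  -- is `weightBound M t`.
  obtain ⟨x, u, hxu, hxX, huw⟩ := (hX.mono_time ht.2).exists_regularVersion hc hi ht.1 hπ
  obtain ⟨y, z, hyz, hyY, hzv⟩ := (hY.mono_time ht.2).exists_regularVersion hc hi ht.1
  have hest := comparison_estimate hc hV ht.1 hπ hxu hyz t htt
  have hconst : t * (fluctuationConstant (weightBound M t * M) * (√N)⁻¹)
      * Real.exp ((3 * M + 2 * weightBound M t * M) * t)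
      ≤ propagationConstant M t * (N : ℝ) ^ (-(1 / 2) : ℝ) := by
    rw [Real.rpow_neg (by positivity), ← Real.sqrt_eq_rpow]
    have h1 : 0 ≤ (√(N : ℝ))⁻¹ := by positivity
    have h2 := le_abs_self (t * fluctuationConstant (weightBound M t * M)
      * Real.exp ((3 * M + 2 * weightBound M t * M) * t))
    unfold propagationConstant
    nlinarith
  refine ⟨fun i => ?_, fun i j hij => ?_⟩
  · have hae : (fun a => ‖x i t a - y t (a i)‖) =ᵐ[mixtureMeasure πs π']
        fun a => ‖X i t a - Y t (a i)‖ := by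
      filter_upwards [hxX i, (hπ.quasiMeasurePreserving_eval i).ae hyY] with a h1 h2
      rw [h1 t htt, h2 t htt]
    refine ⟨(integrable_norm_sub hc hV hπ hxu hyz i htt).congr hae, ?_⟩
    rw [← integral_congr_ae hae]
    exact (hest.1 i).trans hconst
  · have hae : (fun a => |u i j t a - z t (a i, a j)|) =ᵐ[mixtureMeasure πs π']
        fun a => |w i j t a - v t (a i) (a j)| := by
      filter_upwards [huw i j hij, (hπ.quasiMeasurePreserving_eval_pair hij).ae hzv] with a h1 h2
      rw [h1 t htt, h2 t htt]
    refine ⟨(integrable_abs_sub_weight hπ hxu hyz i j t).congr hae, ?_⟩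
    rw [← integral_congr_ae hae]
    exact (hest.2 i j hij).trans hconst

end Main

end

theorem mainTheorem2 :
    -- the constant `C M t` depends only on the time `t` and on a common bound `M` for the data
    ∃ C : ℝ → ℝ → ℝ, (∀ M t, 0 < C M t) ∧
      ∀ (d : ℕ) (k : StateSpaceKind) (c : Coefficients d k) (M : ℝ), c.IsRegular M →
      ∀ (Ω : Type*) [MeasurableSpace Ω] (π : Measure Ω) [IsProbabilityMeasure π]
        (X₀ : Ω → StateSpace d k) (w₀ : Ω → Ω → ℝ), IsInitialTriplet π X₀ w₀ M →
      ∀ (Ω' : Type*) [mΩ' : MeasurableSpace Ω'] (π' : Measure Ω') [IsProbabilityMeasure π']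
        (ℱ : Filtration ℝ mΩ') (T : ℝ) (B : ℝ → Ω' → EuclideanSpace ℝ (Fin d)),
        0 ≤ T → IsBrownianMotionOn π' ℱ T B →
      ∀ (N : ℕ) (πs : Fin N → Measure Ω), 1 ≤ N → IsIndependentMixture π πs →
        -- existence of a solution of the `N`-agent system
        (∃ (X : Fin N → ℝ → (Fin N → Ω × Ω') → StateSpace d k)
            (w : Fin N → Fin N → ℝ → (Fin N → Ω × Ω') → ℝ),
            IsAgentSolution c πs π' ℱ T B X₀ w₀ X w) ∧
        -- almost sure uniqueness
        (∀ (X Y : Fin N → ℝ → (Fin N → Ω × Ω') → StateSpace d k)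
            (w v : Fin N → Fin N → ℝ → (Fin N → Ω × Ω') → ℝ),
            IsAgentSolution c πs π' ℱ T B X₀ w₀ X w →
            IsAgentSolution c πs π' ℱ T B X₀ w₀ Y v →
            ∀ᵐ a ∂mixtureMeasure πs π', ∀ t ∈ Icc 0 T,
              (∀ i, X i t a = Y i t a) ∧ ∀ i j, i ≠ j → w i j t a = v i j t a) ∧
        -- comparison with the independent mixture sampling of the McKean–Vlasov solution
        (∀ (X : Fin N → ℝ → (Fin N → Ω × Ω') → StateSpace d k)
            (w : Fin N → Fin N → ℝ → (Fin N → Ω × Ω') → ℝ)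
            (Xbar : ℝ → Ω × Ω' → StateSpace d k) (wbar : ℝ → Ω × Ω' → Ω × Ω' → ℝ),
            IsAgentSolution c πs π' ℱ T B X₀ w₀ X w →
            IsMcKeanVlasovSolution c π π' ℱ T B X₀ w₀ Xbar wbar →
            ∀ t ∈ Icc 0 T,
              (∀ i,
                Integrable (fun a => ‖X i t a - Xbar t (a i)‖) (mixtureMeasure πs π') ∧
                ∫ a, ‖X i t a - Xbar t (a i)‖ ∂mixtureMeasure πs π'
                  ≤ C M t * (N : ℝ) ^ (-(1 / 2) : ℝ)) ∧
              (∀ i j, i ≠ j →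
                Integrable (fun a => |w i j t a - wbar t (a i) (a j)|) (mixtureMeasure πs π') ∧
                ∫ a, |w i j t a - wbar t (a i) (a j)| ∂mixtureMeasure πs π'
                  ≤ C M t * (N : ℝ) ^ (-(1 / 2) : ℝ))) := by
  refine ⟨propagationConstant, propagationConstant_pos, ?_⟩
  intro d k c M hc Ω _ π _ X₀ w₀ hi Ω' _ π' _ ℱ T B hT hB N πs _ hπ
  exact ⟨exists_isAgentSolution hc hi hT hB hπ, fun X Y w v hX hY => hX.ae_unique hc hY,
    fun X w Y v hX hY t ht => propagation_estimate hc hi hπ hX hY ht⟩
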